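/- **Setting.** Let $dA$ be Lebesgue measure on $\mathbb C$ and $D(z,r)$ the disk with centre $z$ and radius $r$. A weight is a non-negative, locally integrable function $w$ on $\mathbb C$ that is positive almost everywhere; $w(E):=\int_E w\,dA$. For squares $Q\subset\mathbb C$ with sides parallel to the axes and side length $\ell(Q)$, and for $1<p<\infty$, $\frac1p+\frac1{p'}=1$, write $w\in A_p^{\mathrm{restricted}}$ if for some $r>0$ $$\sup_{\ell(Q)=r}\Big(\frac1{A(Q)}\int_Q w\,dA\Big)\Big(\frac1{A(Q)}\int_Q w^{-p'/p}\,dA\Big)^{p/p'}<\infty,$$ and $w\in A_1^{\mathrm{restricted}}$ if for some $r>0$, $\sup_{\ell(Q)=r}\big(\frac1{A(Q)}\int_Q w\,dA\big)\,\|w^{-1}\|_{L^\infty(Q)}<\infty$. Let $A_\infty^{\mathrm{restricted}}=\bigcup_{1\le p<\infty}A_p^{\mathrm{restricted}}$. For $\alpha>0$, $F^2_{\alpha,w}$ is the space of entire functions $f$ with $\|f\|^2=\int_{\mathbb C}|f(z)|^2e^{-\alpha|z|^2}w(z)\,dA(z)<\infty$, with the corresponding inner product. For entire $\varphi,\psi$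 let $W_{\varphi,\psi}f=\psi\cdot(f\circ\varphi)$, and let $$\mu_{\varphi,\psi}(E)=\int_{\varphi^{-1}(E)}|\psi(\xi)|^2e^{-\alpha(|\xi|^2-|\varphi(\xi)|^2)}w(\xi)\,dA(\xi),\qquad M_r(z)=\frac{\mu_{\varphi,\psi}(D(z,r))}{w(D(z,r))}\in[0,\infty].$$ For $0<p<\infty$, a compact operator $T$ on a Hilbert space is in the Schatten class $S_p$ if its singular values $s_n(T)$, i.e. the coefficients in the canonical decomposition $Tx=\sum_n s_n(T)\langle x,e_n\rangle\sigma_n$ with $\{e_n\}$, $\{\sigma_n\}$ orthonormal and $s_n(T)\ge0$ non-increasing with limit $0$, satisfy $\sum_n s_n(T)^p<\infty$. **Corollary.** Let $\alpha>0$ and $w\in A_\infty^{\mathrm{restricted}}$. There exists $\delta\in(0,1)$, depending only on $\alpha$ and $w$, such that for all entire functions $\varphi,\psi$ the following hold. 1. $W_{\varphi,\psi}$ is bounded on $F^2_{\alpha,w}$ if and only if $\sup_{z\in\mathbb C}M_r(z)<\infty$ for some (equivalently, for every) $r\in(0,\delta)$. 2. $W_{\varphi,\psi}$ is compact on $F^2_{\alpha,w}$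 if and only if, for some (equivalently, for every) $r\in(0,\delta)$, $M_r(z)<\infty$ for every $z\in\mathbb C$ and $M_r(z)\to0$ as $|z|\to\infty$. 3. For every $p\ge2$, $W_{\varphi,\psi}\in S_p(F^2_{\alpha,w})$ if and only if $M_r\in L^{p/2}(\mathbb C,dA)$ for some (equivalently, for every) $r\in(0,\delta)$. -/

import Mathlib

open MeasureTheory Filter Topology
open scoped ENNReal

noncomputable section

namespace WeightedFock

/-! ### Weights of restricted `A_∞` type on the complex plane -/

/-- The closed square in `ℂ` with centre `c`, side length `r` and sides parallel to the axes. -/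
def square (c : ℂ) (r : ℝ) : Set ℂ :=
  Set.Icc (c.re - r / 2) (c.re + r / 2) ×ℂ Set.Icc (c.im - r / 2) (c.im + r / 2)

/-- A weight: a non-negative, locally integrable function on `ℂ`, positive almost everywhere.
(Positivity a.e. is the usual convention behind the negative powers of `w` in the `A_p` conditions:
among non-negative locally integrable functions which satisfy such a condition it
removes only the functions that vanish a.e.) -/
structure IsWeight (w : ℂ → ℝ) : Prop where
  nonneg : ∀ z, 0 ≤ w z
  locallyIntegrable : LocallyIntegrable w volume
  ae_pos : ∀ᵐ z ∂(volume : Measure ℂ), 0 < w z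

/-- `sup_{ℓ(Q) = r} (⨍_Q w dA) (⨍_Q w^{-p'/p} dA)^{p/p'}`, as an extended non-negative number;
here `1 < p` and `p'` is the conjugate exponent. -/
def apChar (p r : ℝ) (w : ℂ → ℝ) : ℝ≥0∞ :=
  ⨆ c : ℂ, (⨍⁻ z in square c r, ENNReal.ofReal (w z) ∂volume) *
    (⨍⁻ z in square c r, ENNReal.ofReal (w z) ^ (-(Real.conjExponent p / p)) ∂volume) ^
      (p / Real.conjExponent p)

/-- `sup_{ℓ(Q) = r} (⨍_Q w dA) ‖w⁻¹‖_{L^∞(Q)}`, as an extended non-negative number. -/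
def a1Char (r : ℝ) (w : ℂ → ℝ) : ℝ≥0∞ :=
  ⨆ c : ℂ, (⨍⁻ z in square c r, ENNReal.ofReal (w z) ∂volume) *
    essSup (fun z => (ENNReal.ofReal (w z))⁻¹) (volume.restrict (square c r))

/-- The class `A_p^restricted`, for `1 < p < ∞` (the condition for some side length `r > 0`). -/
def IsRestrictedAp (p : ℝ) (w : ℂ → ℝ) : Prop :=
  IsWeight w ∧ ∃ r : ℝ, 0 < r ∧ apChar p r w < ⊤

/-- The class `A_1^restricted` (the condition for some side length `r > 0`). -/
def IsRestrictedA1 (w : ℂ → ℝ) : Prop :=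
  IsWeight w ∧ ∃ r : ℝ, 0 < r ∧ a1Char r w < ⊤

/-- The class `A_∞^restricted`, the union of the classes `A_p^restricted` for `1 ≤ p < ∞`. -/
def IsRestrictedAInfty (w : ℂ → ℝ) : Prop :=
  IsRestrictedA1 w ∨ ∃ p : ℝ, 1 < p ∧ IsRestrictedAp p w

/-! ### The weighted Fock space -/

/-- The measure `e^{-α|z|²} w(z) dA(z)`. -/
def fockMeasure (α : ℝ) (w : ℂ → ℝ) : Measure ℂ :=
  volume.withDensity fun z => ENNReal.ofReal (Real.exp (-α * ‖z‖ ^ 2) * w z)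

/-- The weighted Fock space `F²_{α,w}`: the (classes of) entire functions in
`L²(e^{-α|z|²} w dA)`, with the inherited norm and inner product. -/
def fockSpace (α : ℝ) (w : ℂ → ℝ) : Submodule ℂ (Lp ℂ 2 (fockMeasure α w)) where
  carrier := {f | ∃ F : ℂ → ℂ, Differentiable ℂ F ∧ f =ᵐ[fockMeasure α w] F}
  add_mem' := by
    rintro f g ⟨F, hF, hfF⟩ ⟨G, hG, hgG⟩
    exact ⟨F + G, hF.add hG, (Lp.coeFn_add f g).trans (hfF.add hgG)⟩
  zero_mem' := ⟨0, differentiable_const 0, Lp.coeFn_zero _ _ _⟩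
  smul_mem' := by
    rintro c f ⟨F, hF, hfF⟩
    exact ⟨c • F, hF.const_smul c, (Lp.coeFn_smul c f).trans (hfF.const_smul c)⟩

/-! ### Weighted composition operators -/

/-- The bounded operator `T` on `F²_{α,w}` is the weighted composition operator
`f ↦ ψ · (f ∘ φ)`. -/
def IsWeightedComposition (α : ℝ) (w : ℂ → ℝ) (φ ψ : ℂ → ℂ)
    (T : fockSpace α w →L[ℂ] fockSpace α w) : Prop :=
  ∀ (f : fockSpace α w) (F : ℂ → ℂ), Differentiable ℂ F →
    (f : Lp ℂ 2 (fockMeasure α w)) =ᵐ[fockMeasure α w] F →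
      (T f : Lp ℂ 2 (fockMeasure α w)) =ᵐ[fockMeasure α w] fun z => ψ z * F (φ z)

/-- `f ↦ ψ · (f ∘ φ)` is a bounded operator on `F²_{α,w}` (in particular it maps `F²_{α,w}` into
itself). -/
def WBounded (α : ℝ) (w : ℂ → ℝ) (φ ψ : ℂ → ℂ) : Prop :=
  ∃ T : fockSpace α w →L[ℂ] fockSpace α w, IsWeightedComposition α w φ ψ T

/-- `f ↦ ψ · (f ∘ φ)` is a compact operator on `F²_{α,w}`. -/
def WCompact (α : ℝ) (w : ℂ → ℝ) (φ ψ : ℂ → ℂ) : Prop :=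
  ∃ T : fockSpace α w →L[ℂ] fockSpace α w,
    IsWeightedComposition α w φ ψ T ∧ IsCompactOperator T

/-- A canonical (singular value) decomposition `T x = ∑ₙ sₙ ⟨x, eₙ⟩ σₙ`: the `sₙ ≥ 0` are
non-increasing with limit `0`, and the vectors `eₙ`, resp. `σₙ`, that occur with
`sₙ ≠ 0` are orthonormal (so that finite rank and finite dimension are covered). -/
structure IsCanonicalDecomposition {H : Type*} [NormedAddCommGroup H] [InnerProductSpace ℂ H]
    (T : H →L[ℂ] H) (s : ℕ → ℝ) (e σ : ℕ → H) : Prop where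
  nonneg : ∀ n, 0 ≤ s n
  antitone : Antitone s
  tendsto_zero : Tendsto s atTop (𝓝 0)
  orthonormal_left : Orthonormal ℂ fun n : {n : ℕ // s n ≠ 0} => e n
  orthonormal_right : Orthonormal ℂ fun n : {n : ℕ // s n ≠ 0} => σ n
  hasSum : ∀ x, HasSum (fun n => ((s n : ℂ) * inner ℂ (e n) x) • σ n) (T x)

/-- The Schatten class `S_p(H)`, `0 < p < ∞`: compact operators with `∑ₙ sₙ(T)^p < ∞`. -/
def MemSchatten {H : Type*} [NormedAddCommGroup H] [InnerProductSpace ℂ H]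
    (p : ℝ) (T : H →L[ℂ] H) : Prop :=
  IsCompactOperator T ∧ ∃ (s : ℕ → ℝ) (e σ : ℕ → H),
    IsCanonicalDecomposition T s e σ ∧ Summable fun n => s n ^ p

/-- `f ↦ ψ · (f ∘ φ)` belongs to `S_p(F²_{α,w})`. -/
def WSchatten (α : ℝ) (w : ℂ → ℝ) (φ ψ : ℂ → ℂ) (p : ℝ) : Prop :=
  ∃ T : fockSpace α w →L[ℂ] fockSpace α w,
    IsWeightedComposition α w φ ψ T ∧ MemSchatten p T

/-! ### The pull-back measure and its averages -/

/-- The measure `μ_{φ,ψ}(E) = ∫_{φ⁻¹(E)} |ψ(z)|² e^{-α(|z|² - |φ(z)|²)} w(z) dA(z)`. -/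
def pullbackMeasure (α : ℝ) (w : ℂ → ℝ) (φ ψ : ℂ → ℂ) : Measure ℂ :=
  (volume.withDensity fun z =>
    ENNReal.ofReal (‖ψ z‖ ^ 2 * Real.exp (-α * (‖z‖ ^ 2 - ‖φ z‖ ^ 2)) * w z)).map φ

/-- The average `μ(D(z,r)) / w(D(z,r))`, where `w(E) = ∫_E w dA`. -/
def avg (μ : Measure ℂ) (w : ℂ → ℝ) (r : ℝ) (z : ℂ) : ℝ≥0∞ :=
  μ (Metric.ball z r) / ∫⁻ ξ in Metric.ball z r, ENNReal.ofReal (w ξ)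

end WeightedFock

end

noncomputable section

namespace WeightedFock

/-! Put W = w dA. The measure μ = μ_{φ,ψ} is built so that ‖W_{φ,ψ} f‖² = ∫ |f|² e^{-α|·|²} dμ
(`IsWeight.lintegral_pullbackMeasure`). Every claim is thus about the embedding of F²_{α,w} into
L²(e^{-α|·|²} dμ), a Carleson measure problem, and the composition operator plays no further role.

The hypothesis on w is used only through `IsLocalAp`, a reverse Jensen inequality on discs of one
fixed radius R. Applied to |F|^{2/p}, with the sub-mean value property, it bounds W(D(z,R)) |F(z)|²
e^{-α|z|²} by the local norm of F (`IsLocalAp.pointwise_le`). Applied to the constant 1, it makes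
W(D(z,R)) and W(D(z,r)) comparable. Hence W(D(·,R)) varies at most exponentially, Gaussians dominate
it, and a Gaussian bump at z has W-mass O(W(D(z,R))) (`IsLocalAp.gaussian_le`).

The pointwise bound and Tonelli give ∫ |F|² e^{-α|·|²} dμ ≤ C ∫ M_r |F|² e^{-α|·|²} dW
(`IsLocalAp.carleson`). Conversely, normalised kernels u_z of the unweighted Fock space satisfy
M_r(z) ≤ C ‖T u_z‖² (`IsLocalAp.avg_le_test`). Boundedness follows at once. For compactness, T u_z →
0 in one direction; in the other, T is small on the functions vanishing on a fine finite net of a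
large disc.

For Schatten classes put q = p/2 ≥ 1 and use Jensen's inequality twice. If T = ∑ sₙ ⟨·,eₙ⟩σₙ, then
M_r(z)^q is bounded by a multiple of ∑ sₙ^p |⟨eₙ,u_z⟩|², and a Gaussian bound for |⟨eₙ,u_z⟩|² has
dA-integral bounded uniformly in n. Conversely, sₙ^p = ‖T eₙ‖^{2q} ≤ C ∫ M^q |eₙ|² e^{-α|·|²} dW;
the sum over n is controlled by the diagonal of the reproducing kernel, of size at most C/W(D(z,R)),
and the measure dW/W(D(z,R)) is traded for dA. -/

/-! ### Sub-mean value property for powers of moduli of entire functions -/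

theorem lintegral_le_of_circle_le {g h : ℂ → ℝ≥0∞} (hg : Measurable g) (hh : Measurable h) (c : ℂ)
    (H : ∀ ρ : ℝ, 0 < ρ → ∫⁻ θ in Set.Ioo (-Real.pi) Real.pi, g (circleMap c ρ θ) ≤
      ∫⁻ θ in Set.Ioo (-Real.pi) Real.pi, h (circleMap c ρ θ)) :
    ∫⁻ z, g z ≤ ∫⁻ z, h z := by
  have key : ∀ k : ℂ → ℝ≥0∞, Measurable k → ∫⁻ z, k z =
      ∫⁻ ρ in Set.Ioi (0 : ℝ), ENNReal.ofReal ρ *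
        ∫⁻ θ in Set.Ioo (-Real.pi) Real.pi, k (circleMap c ρ θ) := by
    intro k hk
    have h1 : ∀ p : ℝ × ℝ, c + Complex.polarCoord.symm p = circleMap c p.1 p.2 := by
      intro p
      rw [Complex.polarCoord_symm_apply, circleMap, Complex.exp_mul_I]
      push_cast
      rfl
    have hcm : Measurable fun p : ℝ × ℝ => k (circleMap c p.1 p.2) := by
      refine hk.comp (Continuous.measurable ?_)
      unfold circleMap
      fun_prop
    rw [← lintegral_add_left_eq_self k c, ← Complex.lintegral_comp_polarCoord_symm]
    simp only [h1, smul_eq_mul]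
    rw [polarCoord_target, Measure.volume_eq_prod, ← Measure.prod_restrict, lintegral_prod _ (by fun_prop)]
    refine lintegral_congr fun ρ => ?_
    have hcm' : Measurable fun θ => k (circleMap c ρ θ) := hcm.comp measurable_prodMk_left
    exact lintegral_const_mul (ENNReal.ofReal ρ) hcm'
  rw [key g hg, key h hh]
  refine setLIntegral_mono' measurableSet_Ioi fun ρ hρ => ?_
  exact mul_le_mul_right (H ρ hρ) _

/-- Jensen's formula makes log|f| sub-harmonic, since each zero in the disc contributes a
non-negative term; convexity of exp transfers this to exp(q log|f|). Every q > 0 is needed, because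
the exponent 2/p used later may be below 1. -/
theorem rpow_norm_le_circleAverage {f : ℂ → ℂ} (hf : Differentiable ℂ f) {c : ℂ} (hc : f c ≠ 0)
    {q ρ : ℝ} (hq : 0 < q) (hρ : 0 < ρ) :
    ‖f c‖ ^ q ≤ Real.circleAverage (fun z => ‖f z‖ ^ q) c ρ := by
  have han : AnalyticOnNhd ℂ f Set.univ := fun z _ => hf.analyticAt z
  have hmero : MeromorphicOn f (Metric.sphere c |ρ|) :=
    fun z _ => (hf.analyticAt z).meromorphicAt
  have hA : 0 < ‖f c‖ ^ q := Real.rpow_pos_of_pos (norm_pos_iff.2 hc) q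
  -- At a zero of f, `Real.log 0 = 0` makes the right side 1 instead of 0, so the two functions
  -- agree only off a discrete set.
  have hcongr : (fun z => ‖f z‖ ^ q) =ᶠ[codiscreteWithin (Metric.sphere c |ρ|)]
      fun z => Real.exp (q * Real.log ‖f z‖) := by
    have : ∀ᶠ z in codiscreteWithin (Set.univ : Set ℂ), f z ≠ 0 := by
      have := han.preimage_zero_mem_codiscreteWithin (x := c) hc (Set.mem_univ _)
        isConnected_univ
      exact this
    filter_upwards [codiscreteWithin_mono (Set.subset_univ _) this] with z hz
    rw [Real.rpow_def_of_pos (norm_pos_iff.2 hz), mul_comm]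
  have hint : CircleIntegrable (fun z => ‖f z‖ ^ q) c ρ := by
    refine ContinuousOn.circleIntegrable' (Continuous.continuousOn ?_)
    exact hf.continuous.norm.rpow_const fun _ => Or.inr hq.le
  rw [Real.circleAverage_congr_codiscreteWithin hcongr hρ.ne']
  have hint2 := hint.congr_codiscreteWithin hcongr
  have hlog := hmero.circleIntegrable_log_norm
  have hJ : Real.log ‖f c‖ ≤ Real.circleAverage (fun z => Real.log ‖f z‖) c ρ := by
    rw [AnalyticOnNhd.circleAverage_log_norm hρ.ne' (han.mono (Set.subset_univ _)) hc]
    have : 0 ≤ ∑ᶠ u, (MeromorphicOn.divisor f (Metric.closedBall c |ρ|) u : ℝ) *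
        Real.log (ρ * ‖c - u‖⁻¹) := by
      refine finsum_nonneg fun u => ?_
      by_cases hu : u ∈ Metric.closedBall c |ρ|
      · refine mul_nonneg ?_ ?_
        · exact_mod_cast (MeromorphicOn.AnalyticOnNhd.divisor_nonneg
            (han.mono (Set.subset_univ _))) u
        · by_cases hcu : c = u
          · simp [hcu]
          · refine Real.log_nonneg ?_
            rw [← div_eq_mul_inv, le_div_iff₀ (norm_pos_iff.2 (sub_ne_zero.2 hcu)), one_mul,
              ← dist_eq_norm, dist_comm]
            rwa [Metric.mem_closedBall, abs_of_pos hρ] at hu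
      · simp [hu]
    linarith
  set A := ‖f c‖ ^ q with hAdef
  have hlogA : Real.log A = q * Real.log ‖f c‖ := Real.log_rpow (norm_pos_iff.2 hc) q
  have hintL : CircleIntegrable (fun z => A * (1 - Real.log A) + (A * q) * Real.log ‖f z‖) c ρ :=
    (circleIntegrable_const _ _ _).add (hlog.const_smul (a := A * q))
  -- The tangent line of exp at log A bounds the integrand below by an affine function of log|f|,
  -- whose average Jensen's formula controls.
  have hmono := Real.circleAverage_mono hintL hint2 (fun z _ => by
    have h1 : q * Real.log ‖f z‖ = Real.log A + (q * Real.log ‖f z‖ - Real.log A) := by ring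
    rw [h1, Real.exp_add, Real.exp_log hA]
    have := Real.add_one_le_exp (q * Real.log ‖f z‖ - Real.log A)
    nlinarith [mul_le_mul_of_nonneg_left this hA.le])
  refine le_trans ?_ hmono
  have hadd := Real.circleAverage_fun_add
    (circleIntegrable_const (A * (1 - Real.log A)) c ρ) (hlog.const_smul (a := A * q))
  simp only [Pi.smul_apply, smul_eq_mul] at hadd
  rw [hadd, Real.circleAverage_const, Real.circleAverage_smul, smul_eq_mul, hlogA]
  nlinarith [mul_le_mul_of_nonneg_left hJ (mul_pos hA hq).le]

/-- Sub-mean value property of `|F|^q`. -/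
theorem volume_ball_mul_rpow_le {F : ℂ → ℂ} (hF : Differentiable ℂ F) (c : ℂ) (r : ℝ) {q : ℝ}
    (hq : 0 < q) :
    volume (Metric.ball c r) * ‖F c‖ₑ ^ q ≤ ∫⁻ z in Metric.ball c r, ‖F z‖ₑ ^ q := by
  by_cases hc : F c = 0
  · simp [hc, hq]
  have hm : Measurable fun z => ‖F z‖ₑ ^ q := (hF.continuous.enorm.measurable).pow_const q
  rw [mul_comm, ← setLIntegral_const, ← lintegral_indicator measurableSet_ball,
    ← lintegral_indicator measurableSet_ball]
  refine lintegral_le_of_circle_le (measurable_const.indicator measurableSet_ball)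
    (hm.indicator measurableSet_ball) c fun ρ hρ => ?_
  by_cases hρr : ρ < r
  · have hmem : ∀ θ, circleMap c ρ θ ∈ Metric.ball c r := fun θ => by
      simpa [circleMap, abs_of_pos hρ] using hρr
    simp only [Set.indicator_of_mem (hmem _), lintegral_const]
    have havg := rpow_norm_le_circleAverage hF hc hq hρ
    rw [Real.circleAverage_eq_integral_add (-Real.pi),
      intervalIntegral.integral_comp_add_right (fun θ => ‖F (circleMap c ρ θ)‖ ^ q)] at havg
    have hcont : Continuous fun θ => ‖F (circleMap c ρ θ)‖ ^ q :=
      (hF.continuous.comp (continuous_circleMap c ρ)).norm.rpow_const fun _ => Or.inr hq.le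
    have e1 : ∀ z, ‖F z‖ₑ ^ q = ENNReal.ofReal (‖F z‖ ^ q) := fun z => by
      rw [← ENNReal.ofReal_rpow_of_nonneg (norm_nonneg _) hq.le, ofReal_norm]
    have h2pi : 2 * Real.pi + -Real.pi = Real.pi := by ring
    rw [zero_add, h2pi, intervalIntegral.integral_of_le (by linarith [Real.pi_pos]),
      integral_Ioc_eq_integral_Ioo, smul_eq_mul, ← div_eq_inv_mul,
      le_div_iff₀ (by positivity)] at havg
    have hint : IntegrableOn (fun θ => ‖F (circleMap c ρ θ)‖ ^ q)
        (Set.Ioo (-Real.pi) Real.pi) :=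
      (hcont.integrableOn_Icc (a := -Real.pi) (b := Real.pi)).mono_set Set.Ioo_subset_Icc_self
    simp only [e1]
    rw [← ofReal_integral_eq_lintegral_ofReal hint (ae_of_all _ fun θ => by positivity)]
    rw [Measure.restrict_apply MeasurableSet.univ, Set.univ_inter, Real.volume_Ioo,
      ← ENNReal.ofReal_mul (by positivity)]
    refine ENNReal.ofReal_le_ofReal (le_trans (le_of_eq ?_) havg)
    ring
  · have hmem : ∀ θ, circleMap c ρ θ ∉ Metric.ball c r := fun θ => by
      simpa [circleMap, abs_of_pos hρ] using hρr
    simp [Set.indicator_of_notMem (hmem _)]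

/-! ### From the restricted `A_p` condition to a reverse Jensen inequality -/

/-- The measure `w dA`. -/
def weightMeasure (w : ℂ → ℝ) : Measure ℂ :=
  volume.withDensity fun z => ENNReal.ofReal (w z)

theorem IsWeight.aemeasurable {w : ℂ → ℝ} (hw : IsWeight w) :
    AEMeasurable (fun z => ENNReal.ofReal (w z)) volume :=
  hw.locallyIntegrable.aestronglyMeasurable.aemeasurable.ennreal_ofReal

theorem ball_subset_square (c : ℂ) (r : ℝ) : Metric.ball c (r / 2) ⊆ square c r := by
  intro z hz
  rw [Metric.mem_ball, dist_eq_norm] at hz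
  have h1 := abs_le.1 ((Complex.abs_re_le_norm (z - c)).trans hz.le)
  have h2 := abs_le.1 ((Complex.abs_im_le_norm (z - c)).trans hz.le)
  simp only [Complex.sub_re, Complex.sub_im] at h1 h2
  rw [square, Complex.mem_reProdIm, Set.mem_Icc, Set.mem_Icc]
  refine ⟨⟨?_, ?_⟩, ?_, ?_⟩ <;> linarith

theorem isCompact_square (c : ℂ) (r : ℝ) : IsCompact (square c r) :=
  isCompact_Icc.reProdIm isCompact_Icc

theorem volume_square (c : ℂ) (r : ℝ) : volume (square c r) = volume (square 0 r) := by
  have : square 0 r = (fun z => c + z) ⁻¹' square c r := by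
    ext z
    simp only [square, Complex.mem_reProdIm, Set.mem_Icc, Set.mem_preimage, Complex.add_re,
      Complex.add_im, Complex.zero_re, Complex.zero_im]
    constructor <;> rintro ⟨⟨_, _⟩, _, _⟩ <;> refine ⟨⟨?_, ?_⟩, ?_, ?_⟩ <;> linarith
  rw [this, measure_preimage_add]

theorem volume_square_ne_zero (c : ℂ) {r : ℝ} (hr : 0 < r) : volume (square c r) ≠ 0 :=
  ((Metric.measure_ball_pos volume c (half_pos hr)).trans_le
    (measure_mono (ball_subset_square c r))).ne'

/-- For p = 2 both exponents p'/p and p/p' equal 1, so the second factor is a mean of w⁻¹, at most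
its essential supremum. The case p = 1 is thereby absorbed into p = 2. -/
theorem apChar_two_le_a1Char (r : ℝ) (w : ℂ → ℝ) : apChar 2 r w ≤ a1Char r w := by
  have h2 : Real.conjExponent 2 = 2 := by norm_num [Real.conjExponent]
  unfold apChar a1Char
  refine iSup_mono fun c => ?_
  gcongr
  rw [h2]
  norm_num only [ENNReal.rpow_one, ENNReal.rpow_neg_one]
  rw [setLAverage_eq]
  refine ENNReal.div_le_of_le_mul ?_
  rw [← setLIntegral_const]
  exact lintegral_mono_ae (ENNReal.ae_le_essSup _)

/-- Exhibits `A_p` as a reverse Jensen inequality at one fixed scale. -/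
def IsLocalAp (p R : ℝ) (A : ℝ≥0∞) (W : Measure ℂ) : Prop :=
  ∀ (z : ℂ) (s : Set ℂ) (g : ℂ → ℝ≥0∞), MeasurableSet s → s ⊆ Metric.ball z R → Measurable g →
    W (Metric.ball z R) * (∫⁻ ζ in s, g ζ) ^ p ≤ A * ∫⁻ ζ in s, g ζ ^ p ∂W

/-- Hölder for g = (g w^{1/p}) · w^{-1/p}; the second factor is integrated over the whole square
circumscribed about the disc of radius r/2. Since 1 + p/p' = p, clearing the two averages leaves the
area of the square to the power p. -/
theorem isLocalAp_of_apChar_lt_top {p r : ℝ} (hp : 1 < p) (hr : 0 < r) {w : ℂ → ℝ}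
    (hw : IsWeight w) :
    IsLocalAp p (r / 2) (apChar p r w * volume (square 0 r) ^ p) (weightMeasure w) := by
  intro z s g hs hsz hg
  set p' := Real.conjExponent p with hp'
  have hpq : p.HolderConjugate p' := Real.HolderConjugate.conjExponent hp
  have hp0 : 0 < p := hpq.pos
  have hp'0 : 0 < p' := hpq.symm.pos
  have hV0 := volume_square_ne_zero 0 hr
  have hVt : volume (square 0 r) ≠ ⊤ := (isCompact_square 0 r).measure_lt_top.ne
  set V := volume (square 0 r) with hV
  set v : ℂ → ℝ≥0∞ := fun z => ENNReal.ofReal (w z) with hv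
  have hvm : AEMeasurable v volume := hw.aemeasurable
  have hpp : 1 + p / p' = p := by
    have := hpq.inv_add_inv_eq_one
    field_simp at this ⊢
    linarith
  -- the `A_p` condition on the square
  have hAp : (∫⁻ ζ in square z r, v ζ) * (∫⁻ ζ in square z r, v ζ ^ (-(p' / p))) ^ (p / p') ≤
      apChar p r w * V ^ p := by
    have h1 : (⨍⁻ ζ in square z r, v ζ ∂volume) *
        (⨍⁻ ζ in square z r, v ζ ^ (-(p' / p)) ∂volume) ^ (p / p') ≤
        apChar p r w := le_iSup (fun c : ℂ => (⨍⁻ z in square c r, ENNReal.ofReal (w z) ∂volume) *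
          (⨍⁻ z in square c r, ENNReal.ofReal (w z) ^ (-(Real.conjExponent p / p)) ∂volume) ^
          (p / Real.conjExponent p)) z
    rw [setLAverage_eq, setLAverage_eq, volume_square z r] at h1
    have h2 := mul_le_mul_left h1 (V ^ p)
    refine le_trans (le_of_eq ?_) h2
    have hVp : V ^ p = V * V ^ (p / p') := by
      nth_rewrite 1 [← hpp]
      rw [ENNReal.rpow_add _ _ hV0 hVt, ENNReal.rpow_one]
    rw [ENNReal.div_rpow_of_nonneg _ _ (by positivity), ← hV, hVp]
    have hVp0 : V ^ (p / p') ≠ 0 := by simp [hV0, hVt]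
    have hVpt : V ^ (p / p') ≠ ⊤ := by
      exact ENNReal.rpow_ne_top_of_nonneg (by positivity) hVt
    rw [show ∀ a b c d : ℝ≥0∞, a / c * (b / d) * (c * d) = (a / c * c) * (b / d * d) by
      intros; ring, ENNReal.div_mul_cancel hV0 hVt, ENNReal.div_mul_cancel hVp0 hVpt]
  -- Hölder
  have hHol : (∫⁻ ζ in s, g ζ) ^ p ≤
      (∫⁻ ζ in s, g ζ ^ p ∂weightMeasure w) * (∫⁻ ζ in s, v ζ ^ (-(p' / p))) ^ (p / p') := by
    have e1 : ∫⁻ ζ in s, g ζ = ∫⁻ ζ in s, (g ζ * v ζ ^ (1 / p)) * v ζ ^ (-(1 / p)) := by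
      refine lintegral_congr_ae (ae_restrict_of_ae ?_)
      filter_upwards [hw.ae_pos] with ζ hζ
      have h0 : v ζ ≠ 0 := by simpa [hv] using hζ
      have ht : v ζ ≠ ⊤ := ENNReal.ofReal_ne_top
      rw [mul_assoc, ← ENNReal.rpow_add _ _ h0 ht]
      simp
    have h3 := ENNReal.lintegral_mul_le_Lp_mul_Lq (volume.restrict s) hpq
      (f := fun ζ => g ζ * v ζ ^ (1 / p)) (g := fun ζ => v ζ ^ (-(1 / p)))
      (hg.aemeasurable.mul (hvm.restrict.pow_const _)) (hvm.restrict.pow_const _)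
    simp only [Pi.mul_apply] at h3
    rw [← e1] at h3
    have h4 := ENNReal.rpow_le_rpow h3 hp0.le
    refine h4.trans (le_of_eq ?_)
    rw [ENNReal.mul_rpow_of_nonneg _ _ hp0.le, ← ENNReal.rpow_mul, ← ENNReal.rpow_mul,
      one_div_mul_cancel hp0.ne', ENNReal.rpow_one, one_div_mul_eq_div]
    congr 1
    · rw [weightMeasure, restrict_withDensity hs, lintegral_withDensity_eq_lintegral_mul₀
        hvm.restrict (hg.pow_const p).aemeasurable]
      refine lintegral_congr fun ζ => ?_
      simp only [Pi.mul_apply]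
      rw [ENNReal.mul_rpow_of_nonneg _ _ hp0.le, ← ENNReal.rpow_mul, one_div_mul_cancel hp0.ne',
        ENNReal.rpow_one, mul_comm]
    · congr 1
      refine lintegral_congr fun ζ => ?_
      rw [← ENNReal.rpow_mul]
      congr 1
      field_simp
  have hsub : s ⊆ square z r := hsz.trans (ball_subset_square z r)
  have hball : weightMeasure w (Metric.ball z (r / 2)) ≤ ∫⁻ ζ in square z r, v ζ := by
    rw [weightMeasure, withDensity_apply _ measurableSet_ball]
    exact lintegral_mono_set (ball_subset_square z r)
  calc weightMeasure w (Metric.ball z (r / 2)) * (∫⁻ ζ in s, g ζ) ^ p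
      ≤ (∫⁻ ζ in square z r, v ζ) * ((∫⁻ ζ in s, g ζ ^ p ∂weightMeasure w) *
        (∫⁻ ζ in square z r, v ζ ^ (-(p' / p))) ^ (p / p')) := by
        refine mul_le_mul' hball (hHol.trans ?_)
        gcongr
    _ = ((∫⁻ ζ in square z r, v ζ) * (∫⁻ ζ in square z r, v ζ ^ (-(p' / p))) ^ (p / p')) *
        ∫⁻ ζ in s, g ζ ^ p ∂weightMeasure w := by ring
    _ ≤ _ := by gcongr

theorem IsRestrictedAInfty.isWeight {w : ℂ → ℝ} (hw : IsRestrictedAInfty w) : IsWeight w := by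
  rcases hw with h | ⟨p, -, h⟩ <;> exact h.1

theorem IsRestrictedAInfty.exists_isLocalAp {w : ℂ → ℝ} (hw : IsRestrictedAInfty w) :
    ∃ (p R : ℝ) (A : ℝ≥0∞), 1 < p ∧ 0 < R ∧ A ≠ ⊤ ∧ IsLocalAp p R A (weightMeasure w) := by
  obtain ⟨p, r, hp, hr, h⟩ : ∃ p r : ℝ, 1 < p ∧ 0 < r ∧ apChar p r w < ⊤ := by
    rcases hw with ⟨-, r, hr, h⟩ | ⟨p, hp, -, r, hr, h⟩
    · exact ⟨2, r, one_lt_two, hr, (apChar_two_le_a1Char r w).trans_lt h⟩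
    · exact ⟨p, r, hp, hr, h⟩
  refine ⟨p, r / 2, _, hp, half_pos hr, ENNReal.mul_ne_top h.ne ?_,
    isLocalAp_of_apChar_lt_top hp hr hw.isWeight⟩
  exact ENNReal.rpow_ne_top_of_nonneg (by linarith) (isCompact_square 0 r).measure_lt_top.ne

theorem IsWeight.isLocallyFiniteMeasure {w : ℂ → ℝ} (hw : IsWeight w) :
    IsLocallyFiniteMeasure (weightMeasure w) := by
  refine ⟨fun x => ?_⟩
  obtain ⟨s, hs, hint⟩ := hw.locallyIntegrable x
  refine ⟨s, hs, ?_⟩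
  rw [weightMeasure, withDensity_apply']
  exact hint.lintegral_lt_top

theorem IsWeight.absolutelyContinuous {w : ℂ → ℝ} (hw : IsWeight w) :
    volume ≪ weightMeasure w := by
  refine withDensity_absolutelyContinuous' hw.aemeasurable ?_
  filter_upwards [hw.ae_pos] with z hz
  simpa using hz

theorem IsWeight.isOpenPosMeasure {w : ℂ → ℝ} (hw : IsWeight w) :
    (weightMeasure w).IsOpenPosMeasure :=
  hw.absolutelyContinuous.isOpenPosMeasure

/-! ### Tonelli over discs and Gaussian integrals -/

/-- The set {|a - b| < r} is symmetric, so Tonelli applies. Local estimates become global ones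
through this exchange. -/
theorem lintegral_ball_swap (μ ν : Measure ℂ) [SFinite μ] [SFinite ν] (r : ℝ)
    {f : ℂ → ℂ → ℝ≥0∞} (hf : Measurable (Function.uncurry f)) :
    ∫⁻ a, ∫⁻ b in Metric.ball a r, f a b ∂ν ∂μ = ∫⁻ b, ∫⁻ a in Metric.ball b r, f a b ∂μ ∂ν := by
  have hS : MeasurableSet {x : ℂ × ℂ | dist x.1 x.2 < r} :=
    (isOpen_lt continuous_dist continuous_const).measurableSet
  have h1 : ∀ a b, (Metric.ball a r).indicator (f a) b =
      {x : ℂ × ℂ | dist x.1 x.2 < r}.indicator (Function.uncurry f) (a, b) := fun a b => by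
    simp [Set.indicator, dist_comm]
  have h2 : ∀ a b, (Metric.ball b r).indicator (fun a => f a b) a =
      {x : ℂ × ℂ | dist x.1 x.2 < r}.indicator (Function.uncurry f) (a, b) := fun a b => by
    simp [Set.indicator]
  simp only [← lintegral_indicator measurableSet_ball, h1, h2]
  exact lintegral_lintegral_swap (hf.indicator hS).aemeasurable

theorem measurable_measure_ball (μ : Measure ℂ) [SFinite μ] (r : ℝ) :
    Measurable fun z => μ (Metric.ball z r) := by
  have hS : MeasurableSet {x : ℂ × ℂ | dist x.2 x.1 < r} :=
    (isOpen_lt (continuous_snd.dist continuous_fst) continuous_const).measurableSet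
  exact measurable_measure_prodMk_left hS

theorem lintegral_gaussian_lt_top {b : ℝ} (hb : 0 < b) :
    ∫⁻ z : ℂ, ENNReal.ofReal (Real.exp (-b * ‖z‖ ^ 2)) < ⊤ := by
  -- A non-integrable function has Bochner integral 0, so a non-zero value already proves
  -- integrability.
  have h : ∫ z : ℂ, Real.exp (-b * ‖z‖ ^ 2) ≠ 0 := by
    rw [GaussianFourier.integral_rexp_neg_mul_sq_norm hb]
    positivity
  exact (Integrable.of_integral_ne_zero h).lintegral_lt_top

theorem lintegral_gaussian_sub (b : ℝ) (c : ℂ) :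
    ∫⁻ z : ℂ, ENNReal.ofReal (Real.exp (-b * ‖z - c‖ ^ 2)) =
      ∫⁻ z : ℂ, ENNReal.ofReal (Real.exp (-b * ‖z‖ ^ 2)) :=
  lintegral_sub_right_eq_self (fun z : ℂ => ENNReal.ofReal (Real.exp (-b * ‖z‖ ^ 2))) c

/-- `|F(z)|² e^{-α|z|²}`. -/
def fockDensity (α : ℝ) (F : ℂ → ℂ) (z : ℂ) : ℝ≥0∞ :=
  ‖F z‖ₑ ^ 2 * ENNReal.ofReal (Real.exp (-α * ‖z‖ ^ 2))

theorem measurable_fockDensity (α : ℝ) {F : ℂ → ℂ} (hF : Continuous F) :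
    Measurable (fockDensity α F) := by
  unfold fockDensity
  have h1 : Measurable fun z => ‖F z‖ₑ := hF.enorm.measurable
  have h2 : Measurable fun z : ℂ => Real.exp (-α * ‖z‖ ^ 2) := by fun_prop
  exact (h1.pow_const 2).mul h2.ennreal_ofReal

theorem ENNReal_le_inv_mul {a b c : ℝ≥0∞} (h0 : a ≠ 0) (ht : a ≠ ⊤) (h : a * b ≤ c) :
    b ≤ a⁻¹ * c := by
  calc b = a⁻¹ * (a * b) := by rw [← mul_assoc, ENNReal.inv_mul_cancel h0 ht, one_mul]
    _ ≤ a⁻¹ * c := mul_le_mul_right h _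

/-! ### Pointwise estimates, doubling and growth of the weight -/

section LocalAp

variable {p R : ℝ} {A : ℝ≥0∞} {W : Measure ℂ}

theorem measure_ball_ne_top (W : Measure ℂ) [IsLocallyFiniteMeasure W] (z : ℂ) (r : ℝ) :
    W (Metric.ball z r) ≠ ⊤ :=
  measure_ball_lt_top.ne

theorem measure_ball_ne_zero (W : Measure ℂ) [W.IsOpenPosMeasure] (z : ℂ) {r : ℝ} (hr : 0 < r) :
    W (Metric.ball z r) ≠ 0 :=
  (Metric.measure_ball_pos W z hr).ne'

theorem volume_ball_eq (z : ℂ) (r : ℝ) :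
    volume (Metric.ball z r) = volume (Metric.ball (0 : ℂ) r) :=
  Measure.addHaar_ball_center volume z r

/-- The factor exp(-α z̄(ζ - z)) freezes the Gaussian at z: |G(ζ)|² e^{-α|z|²} = |F(ζ)|² e^{-α|ζ|²}
e^{α|ζ-z|²}, and the last factor is at most e^{αr²} on the disc. The sub-mean value property is used
with exponent 2/p, so that the p-th power in `IsLocalAp` restores |G|². -/
theorem IsLocalAp.pointwise_le (h : IsLocalAp p R A W) (hp : 1 < p) (hA : A ≠ ⊤) (α : ℝ)
    (hα : 0 < α) {r : ℝ} (hr : 0 < r) (hrR : r ≤ R) :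
    ∃ C : ℝ≥0∞, C ≠ ⊤ ∧ ∀ F : ℂ → ℂ, Differentiable ℂ F → ∀ z,
      W (Metric.ball z R) * fockDensity α F z ≤
        C * ∫⁻ ζ in Metric.ball z r, fockDensity α F ζ ∂W := by
  have hp0 : 0 < p := by linarith
  set V := volume (Metric.ball (0 : ℂ) r) with hV
  have hV0 : V ≠ 0 := measure_ball_ne_zero volume 0 hr
  have hVt : V ≠ ⊤ := measure_ball_ne_top volume 0 r
  have hVp0 : V ^ p ≠ 0 := by simp [hV0, hVt]
  have hVpt : V ^ p ≠ ⊤ := ENNReal.rpow_ne_top_of_nonneg hp0.le hVt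
  refine ⟨(V ^ p)⁻¹ * (A * ENNReal.ofReal (Real.exp (α * r ^ 2))),
    ENNReal.mul_ne_top (ENNReal.inv_ne_top.2 hVp0) (ENNReal.mul_ne_top hA ENNReal.ofReal_ne_top),
    fun F hF z => ?_⟩
  set G : ℂ → ℂ := fun ζ => F ζ * Complex.exp (-α * (starRingEnd ℂ) z * (ζ - z)) with hG
  have hGd : Differentiable ℂ G := by fun_prop
  have hGz : G z = F z := by simp [hG]
  have h1 := volume_ball_mul_rpow_le hGd z r (q := 2 / p) (by positivity)
  rw [volume_ball_eq, ← hV, hGz] at h1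
  have h2 := ENNReal.rpow_le_rpow h1 hp0.le
  rw [ENNReal.mul_rpow_of_nonneg _ _ hp0.le, ← ENNReal.rpow_mul, div_mul_cancel₀ _ hp0.ne'] at h2
  have h3 := h z (Metric.ball z r) (fun ζ => ‖G ζ‖ₑ ^ (2 / p)) measurableSet_ball
    (Metric.ball_subset_ball hrR) (hGd.continuous.enorm.measurable.pow_const _)
  simp only [← ENNReal.rpow_mul, div_mul_cancel₀ _ hp0.ne', ENNReal.rpow_two] at h2 h3
  have h4 : (∫⁻ ζ in Metric.ball z r, ‖G ζ‖ₑ ^ 2 ∂W) * ENNReal.ofReal (Real.exp (-α * ‖z‖ ^ 2)) ≤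
      ENNReal.ofReal (Real.exp (α * r ^ 2)) * ∫⁻ ζ in Metric.ball z r, fockDensity α F ζ ∂W := by
    rw [← lintegral_mul_const' _ _ ENNReal.ofReal_ne_top,
      ← lintegral_const_mul' _ _ ENNReal.ofReal_ne_top]
    refine setLIntegral_mono' measurableSet_ball fun ζ hζ => ?_
    rw [Metric.mem_ball, dist_eq_norm] at hζ
    suffices hE : ‖Complex.exp (-α * (starRingEnd ℂ) z * (ζ - z))‖ₑ ^ 2 *
        ENNReal.ofReal (Real.exp (-α * ‖z‖ ^ 2)) ≤
        ENNReal.ofReal (Real.exp (α * r ^ 2)) * ENNReal.ofReal (Real.exp (-α * ‖ζ‖ ^ 2)) by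
      calc _ = ‖F ζ‖ₑ ^ 2 * (‖Complex.exp (-α * (starRingEnd ℂ) z * (ζ - z))‖ₑ ^ 2 *
            ENNReal.ofReal (Real.exp (-α * ‖z‖ ^ 2))) := by rw [hG, enorm_mul, mul_pow, mul_assoc]
        _ ≤ ‖F ζ‖ₑ ^ 2 * (ENNReal.ofReal (Real.exp (α * r ^ 2)) *
            ENNReal.ofReal (Real.exp (-α * ‖ζ‖ ^ 2))) := mul_le_mul_right hE _
        _ = _ := by rw [fockDensity]; ring
    rw [← ofReal_norm, ← ENNReal.ofReal_pow (norm_nonneg _), ← ENNReal.ofReal_mul (by positivity),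
      ← ENNReal.ofReal_mul (by positivity), Complex.norm_exp, ← Real.exp_nat_mul, ← Real.exp_add,
      ← Real.exp_add]
    refine ENNReal.ofReal_le_ofReal (Real.exp_le_exp.2 ?_)
    have hsq : ‖ζ - z‖ ^ 2 ≤ r ^ 2 := pow_le_pow_left₀ (norm_nonneg _) hζ.le 2
    rw [Complex.sq_norm, Complex.normSq_apply] at *
    simp only [Complex.sq_norm, Complex.normSq_apply, Complex.mul_re, Complex.mul_im,
      Complex.sub_re, Complex.sub_im, Complex.conj_re, Complex.conj_im, Complex.neg_re,
      Complex.neg_im, Complex.ofReal_re, Complex.ofReal_im] at *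
    push_cast
    nlinarith [mul_le_mul_of_nonneg_left hsq hα.le]
  have h5 : V ^ p * (W (Metric.ball z R) * fockDensity α F z) ≤
      A * ENNReal.ofReal (Real.exp (α * r ^ 2)) *
        ∫⁻ ζ in Metric.ball z r, fockDensity α F ζ ∂W := by
    calc V ^ p * (W (Metric.ball z R) * fockDensity α F z)
        = W (Metric.ball z R) * (V ^ p * ‖F z‖ₑ ^ 2) *
          ENNReal.ofReal (Real.exp (-α * ‖z‖ ^ 2)) := by rw [fockDensity]; ring
      _ ≤ A * (∫⁻ ζ in Metric.ball z r, ‖G ζ‖ₑ ^ 2 ∂W) *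
          ENNReal.ofReal (Real.exp (-α * ‖z‖ ^ 2)) := by
          exact mul_le_mul_left ((mul_le_mul_right h2 _).trans h3) _
      _ ≤ _ := by
          rw [mul_assoc, mul_assoc]
          exact mul_le_mul_right h4 _
  rw [mul_assoc]
  exact ENNReal_le_inv_mul hVp0 hVpt h5

/-- The case g = 1 of the reverse Jensen inequality on the smaller disc. -/
theorem IsLocalAp.measure_ball_le (h : IsLocalAp p R A W) (hp : 1 < p) (hA : A ≠ ⊤)
    {r : ℝ} (hr : 0 < r) (hrR : r ≤ R) :
    ∃ C : ℝ≥0∞, C ≠ ⊤ ∧ ∀ z, W (Metric.ball z R) ≤ C * W (Metric.ball z r) := by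
  have hp0 : 0 < p := by linarith
  set V := volume (Metric.ball (0 : ℂ) r) with hV
  have hV0 : V ≠ 0 := measure_ball_ne_zero volume 0 hr
  have hVt : V ≠ ⊤ := measure_ball_ne_top volume 0 r
  have hVp0 : V ^ p ≠ 0 := by simp [hV0, hVt]
  have hVpt : V ^ p ≠ ⊤ := ENNReal.rpow_ne_top_of_nonneg hp0.le hVt
  refine ⟨(V ^ p)⁻¹ * A, ENNReal.mul_ne_top (ENNReal.inv_ne_top.2 hVp0) hA, fun z => ?_⟩
  have h3 := h z (Metric.ball z r) (fun ζ => 1) measurableSet_ball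
    (Metric.ball_subset_ball hrR) measurable_const
  simp only [ENNReal.one_rpow, setLIntegral_const, one_mul] at h3
  rw [volume_ball_eq, ← hV] at h3
  rw [mul_assoc]
  exact ENNReal_le_inv_mul hVp0 hVpt ((mul_comm _ _).trans_le h3)

theorem IsLocalAp.measure_ball_le_of_dist_le (h : IsLocalAp p R A W) (hp : 1 < p) (hR : 0 < R)
    (hA : A ≠ ⊤) :
    ∃ C : ℝ≥0∞, C ≠ ⊤ ∧ ∀ z z', dist z z' ≤ R / 2 →
      W (Metric.ball z R) ≤ C * W (Metric.ball z' R) := by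
  obtain ⟨C, hC, h1⟩ := h.measure_ball_le hp hA (half_pos hR) (by linarith)
  refine ⟨C, hC, fun z z' hd => (h1 z).trans (mul_le_mul_right (measure_mono ?_) _)⟩
  exact Metric.ball_subset_ball' (by linarith)

/-- The comparison at distance R/2 is iterated along the segment from z to z', in about 2|z' - z|/R
steps. The growth is only exponential, hence negligible against a Gaussian. -/
theorem IsLocalAp.growth (h : IsLocalAp p R A W) (hp : 1 < p) (hR : 0 < R) (hA : A ≠ ⊤) :
    ∃ K κ : ℝ, 0 < K ∧ 0 ≤ κ ∧ ∀ z z', W (Metric.ball z' R) ≤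
      ENNReal.ofReal (K * Real.exp (κ * ‖z' - z‖)) * W (Metric.ball z R) := by
  obtain ⟨C, hC, h1⟩ := h.measure_ball_le_of_dist_le hp hR hA
  set c : ℝ := max 1 C.toReal with hc
  have hc1 : 1 ≤ c := le_max_left _ _
  have hCc : C ≤ ENNReal.ofReal c := by
    rw [← ENNReal.ofReal_toReal hC]
    exact ENNReal.ofReal_le_ofReal (le_max_right _ _)
  have hiter : ∀ (n : ℕ) (z z' : ℂ), ‖z' - z‖ ≤ n * (R / 2) →
      W (Metric.ball z' R) ≤ ENNReal.ofReal (c ^ n) * W (Metric.ball z R) := by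
    intro n
    induction n with
    | zero =>
      intro z z' hz
      have : z' = z := by simpa [sub_eq_zero] using hz
      simp [this]
    | succ n ih =>
      intro z z' hz
      push_cast at hz
      have hn : (0 : ℝ) < n + 1 := by positivity
      set t : ℂ := ((1 / ((n : ℝ) + 1) : ℝ) : ℂ) with ht
      have htn : ‖t‖ = 1 / ((n : ℝ) + 1) := by
        rw [ht, Complex.norm_real, Real.norm_of_nonneg (by positivity)]
      have htn' : ‖1 - t‖ = n / ((n : ℝ) + 1) := by
        have : 1 - t = ((n / ((n : ℝ) + 1) : ℝ) : ℂ) := by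
          have h0 : ((n : ℂ) + 1) ≠ 0 := by exact_mod_cast hn.ne'
          rw [ht]; push_cast; field_simp; ring
        rw [this, Complex.norm_real, Real.norm_of_nonneg (by positivity)]
      -- The first of n + 1 equal steps along the segment.
      set y := z + t * (z' - z) with hy
      have hy1 : dist y z ≤ R / 2 := by
        rw [hy, dist_eq_norm, add_sub_cancel_left, norm_mul, htn, one_div, inv_mul_le_iff₀ hn]
        exact hz
      have hy2 : ‖z' - y‖ ≤ n * (R / 2) := by
        have : z' - y = (1 - t) * (z' - z) := by rw [hy]; ring
        rw [this, norm_mul, htn', div_mul_eq_mul_div, div_le_iff₀ hn]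
        nlinarith [mul_le_mul_of_nonneg_left hz (Nat.cast_nonneg (α := ℝ) n)]
      calc W (Metric.ball z' R) ≤ ENNReal.ofReal (c ^ n) * W (Metric.ball y R) := ih y z' hy2
        _ ≤ ENNReal.ofReal (c ^ n) * (ENNReal.ofReal c * W (Metric.ball z R)) := by
          gcongr
          exact (h1 y z hy1).trans (mul_le_mul_left hCc _)
        _ = _ := by
          rw [← mul_assoc, ← ENNReal.ofReal_mul (by positivity), pow_succ]
  -- The exponential comes from c^(2|z' - z|/R); the extra factor c pays for rounding the number of
  -- steps up.
  refine ⟨c, Real.log c * (2 / R), by positivity, by positivity [Real.log_nonneg hc1],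
    fun z z' => ?_⟩
  set n := ⌈‖z' - z‖ * (2 / R)⌉₊ with hn
  have hle : ‖z' - z‖ ≤ n * (R / 2) := by
    have := Nat.le_ceil (‖z' - z‖ * (2 / R))
    rw [← hn, mul_div_assoc', div_le_iff₀ hR] at this
    linarith
  have hlt : (n : ℝ) ≤ ‖z' - z‖ * (2 / R) + 1 := (Nat.ceil_lt_add_one (by positivity)).le
  refine (hiter n z z' hle).trans (mul_le_mul_left (ENNReal.ofReal_le_ofReal ?_) _)
  have hc0 : 0 < c := by linarith
  rw [← Real.rpow_natCast, Real.rpow_def_of_pos hc0]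
  nth_rewrite 2 [← Real.exp_log hc0]
  rw [← Real.exp_add]
  refine Real.exp_le_exp.2 ?_
  nlinarith [mul_le_mul_of_nonneg_left hlt (Real.log_nonneg hc1)]

/-- The Gaussian at ζ is averaged over the disc D(ζ,R) and Tonelli applied, which replaces W by the
function W(D(η,R)) against dA. Halving the Gaussian exponent absorbs the shift from ζ to η; halving
it again absorbs the exponential growth. -/
theorem IsLocalAp.gaussian_le [IsLocallyFiniteMeasure W] (h : IsLocalAp p R A W) (hp : 1 < p)
    (hR : 0 < R) (hA : A ≠ ⊤) {β : ℝ} (hβ : 0 < β) :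
    ∃ C : ℝ≥0∞, C ≠ ⊤ ∧ ∀ z, ∫⁻ ζ, ENNReal.ofReal (Real.exp (-β * ‖ζ - z‖ ^ 2)) ∂W ≤
      C * W (Metric.ball z R) := by
  obtain ⟨K, κ, hK, hκ, hgr⟩ := h.growth hp hR hA
  set V := volume (Metric.ball (0 : ℂ) R) with hV
  have hV0 : V ≠ 0 := measure_ball_ne_zero volume 0 hR
  have hVt : V ≠ ⊤ := measure_ball_ne_top volume 0 R
  set D := ENNReal.ofReal (Real.exp (β * R ^ 2) * K * Real.exp (κ ^ 2 / β)) with hD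
  set I := ∫⁻ z : ℂ, ENNReal.ofReal (Real.exp (-(β / 4) * ‖z‖ ^ 2)) with hI
  refine ⟨V⁻¹ * (D * I), ENNReal.mul_ne_top (ENNReal.inv_ne_top.2 hV0)
    (ENNReal.mul_ne_top ENNReal.ofReal_ne_top (lintegral_gaussian_lt_top (by positivity)).ne),
    fun z => ?_⟩
  rw [mul_assoc]
  refine ENNReal_le_inv_mul hV0 hVt ?_
  have hmE : Measurable fun ζ : ℂ => ENNReal.ofReal (Real.exp (-β * ‖ζ - z‖ ^ 2)) := by fun_prop
  calc V * ∫⁻ ζ, ENNReal.ofReal (Real.exp (-β * ‖ζ - z‖ ^ 2)) ∂W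
      = ∫⁻ ζ, (∫⁻ _ in Metric.ball ζ R, ENNReal.ofReal (Real.exp (-β * ‖ζ - z‖ ^ 2))) ∂W := by
        rw [← lintegral_const_mul _ hmE]
        refine lintegral_congr fun ζ => ?_
        rw [setLIntegral_const, volume_ball_eq, mul_comm]
    _ = ∫⁻ η, (∫⁻ ζ in Metric.ball η R, ENNReal.ofReal (Real.exp (-β * ‖ζ - z‖ ^ 2)) ∂W) :=
        lintegral_ball_swap W volume R (hmE.comp measurable_fst)
    _ ≤ ∫⁻ η, D * W (Metric.ball z R) *
          ENNReal.ofReal (Real.exp (-(β / 4) * ‖η - z‖ ^ 2)) := by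
        refine lintegral_mono fun η => ?_
        have h1 : ∫⁻ ζ in Metric.ball η R, ENNReal.ofReal (Real.exp (-β * ‖ζ - z‖ ^ 2)) ∂W ≤
            ENNReal.ofReal (Real.exp (β * R ^ 2 - β / 2 * ‖η - z‖ ^ 2)) * W (Metric.ball η R) := by
          rw [← setLIntegral_const]
          refine setLIntegral_mono' measurableSet_ball fun ζ hζ => ?_
          rw [Metric.mem_ball, dist_eq_norm] at hζ
          refine ENNReal.ofReal_le_ofReal (Real.exp_le_exp.2 ?_)
          have h2 : ‖η - z‖ ≤ ‖ζ - z‖ + R := by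
            have : η - z = (ζ - z) - (ζ - η) := by ring
            rw [this]
            exact (norm_sub_le _ _).trans (by linarith)
          have h3 : ‖η - z‖ ^ 2 ≤ 2 * ‖ζ - z‖ ^ 2 + 2 * R ^ 2 := by
            nlinarith [norm_nonneg (η - z), norm_nonneg (ζ - z), sq_nonneg (‖ζ - z‖ - R)]
          nlinarith
        refine h1.trans ((mul_le_mul_right (hgr z η) _).trans ?_)
        rw [← mul_assoc, ← ENNReal.ofReal_mul (by positivity), mul_right_comm, hD,
          ← ENNReal.ofReal_mul (by positivity)]
        refine mul_le_mul_left (ENNReal.ofReal_le_ofReal ?_) _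
        have e1 : Real.exp (β * R ^ 2 - β / 2 * ‖η - z‖ ^ 2) * (K * Real.exp (κ * ‖η - z‖)) =
            K * Real.exp (β * R ^ 2 - β / 2 * ‖η - z‖ ^ 2 + κ * ‖η - z‖) := by
          rw [Real.exp_add]; ring
        have e2 : Real.exp (β * R ^ 2) * K * Real.exp (κ ^ 2 / β) *
            Real.exp (-(β / 4) * ‖η - z‖ ^ 2) =
            K * Real.exp (β * R ^ 2 + κ ^ 2 / β + -(β / 4) * ‖η - z‖ ^ 2) := by
          rw [Real.exp_add, Real.exp_add]; ring
        rw [e1, e2]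
        refine mul_le_mul_of_nonneg_left (Real.exp_le_exp.2 ?_) hK.le
        -- Completing the square; the constant κ²/β is the last factor of D.
        have h4 : κ * ‖η - z‖ ≤ β / 4 * ‖η - z‖ ^ 2 + κ ^ 2 / β := by
          have := sq_nonneg (β / 2 * ‖η - z‖ - κ)
          rw [← sub_nonneg]
          have h5 : β / 4 * ‖η - z‖ ^ 2 + κ ^ 2 / β - κ * ‖η - z‖ =
              (β / 2 * ‖η - z‖ - κ) ^ 2 / β := by field_simp; ring
          rw [h5]; positivity
        linarith
    _ = D * I * W (Metric.ball z R) := by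
        rw [lintegral_const_mul _ (by fun_prop), lintegral_gaussian_sub]
        ring

end LocalAp

/-! ### Unnormalised Jensen inequality and Gaussian test functions -/

theorem ENNReal_inv_le {a b C : ℝ≥0∞} (ha : a ≠ 0) (hC : C ≠ ⊤) (h : a ≤ C * b) :
    b⁻¹ ≤ C * a⁻¹ := by
  have hC0 : C ≠ 0 := by
    rintro rfl
    simp [ha] at h
  have h1 : (C * b)⁻¹ ≤ a⁻¹ := ENNReal.inv_le_inv.2 h
  rw [ENNReal.mul_inv (Or.inl hC0) (Or.inl hC)] at h1
  calc b⁻¹ = C * (C⁻¹ * b⁻¹) := by rw [← mul_assoc, ENNReal.mul_inv_cancel hC0 hC, one_mul]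
    _ ≤ C * a⁻¹ := mul_le_mul_right h1 _

/-- Hölder for f g = (f g^{1/q}) g^{1/q'}: Jensen's inequality for the measure g dm, without
normalising its mass. The restriction to Schatten exponents at least 2 comes from the condition q ≥
1 here and in its version for sums. -/
theorem lintegral_mul_rpow_le {X : Type*} [MeasurableSpace X] {m : Measure X} {q : ℝ} (hq : 1 ≤ q)
    {f g : X → ℝ≥0∞} (hf : AEMeasurable f m) (hg : AEMeasurable g m) :
    (∫⁻ x, f x * g x ∂m) ^ q ≤ (∫⁻ x, g x ∂m) ^ (q - 1) * ∫⁻ x, f x ^ q * g x ∂m := by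
  rcases hq.eq_or_lt with rfl | hq
  · simp
  have hpq : q.HolderConjugate (Real.conjExponent q) := Real.HolderConjugate.conjExponent hq
  set q' := Real.conjExponent q
  have hq0 : 0 < q := hpq.pos
  have hq'0 : 0 < q' := hpq.symm.pos
  have hsum : 1 / q + 1 / q' = 1 := by simpa using hpq.inv_add_inv_eq_one
  have h1 := ENNReal.lintegral_mul_le_Lp_mul_Lq m hpq (f := fun x => f x * g x ^ (1 / q))
    (g := fun x => g x ^ (1 / q')) (hf.mul (hg.pow_const _)) (hg.pow_const _)
  have e : ∫⁻ x, f x * g x ∂m = ∫⁻ x, (f x * g x ^ (1 / q)) * g x ^ (1 / q') ∂m := by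
    refine lintegral_congr fun x => ?_
    rw [mul_assoc, ← ENNReal.rpow_add_of_nonneg _ _ (by positivity) (by positivity), hsum,
      ENNReal.rpow_one]
  simp only [Pi.mul_apply] at h1
  rw [← e] at h1
  have h2 := ENNReal.rpow_le_rpow h1 hq0.le
  refine h2.trans (le_of_eq ?_)
  have h3 : 1 / q' * q = q - 1 := by
    field_simp at hsum ⊢
    linarith
  rw [ENNReal.mul_rpow_of_nonneg _ _ hq0.le, ← ENNReal.rpow_mul, ← ENNReal.rpow_mul,
    one_div_mul_cancel hq0.ne', ENNReal.rpow_one, h3, mul_comm]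
  congr 1
  · congr 1
    refine lintegral_congr fun x => ?_
    rw [← ENNReal.rpow_mul, one_div_mul_cancel hq'0.ne', ENNReal.rpow_one]
  · refine lintegral_congr fun x => ?_
    rw [ENNReal.mul_rpow_of_nonneg _ _ hq0.le, ← ENNReal.rpow_mul, one_div_mul_cancel hq0.ne',
      ENNReal.rpow_one]

theorem tsum_mul_rpow_le {ι : Type*} {q : ℝ} (hq : 1 ≤ q) (f g : ι → ℝ≥0∞) :
    (∑' i, f i * g i) ^ q ≤ (∑' i, g i) ^ (q - 1) * ∑' i, f i ^ q * g i := by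
  let _ : MeasurableSpace ι := ⊤
  have := lintegral_mul_rpow_le (m := Measure.count) hq (f := f) (g := g)
    (measurable_from_top.aemeasurable) (measurable_from_top.aemeasurable)
  simpa only [lintegral_count] using this

/-- The entire function `ζ ↦ exp(α z̄ ζ - α|z|²/2)`. -/
def gaussTest (α : ℝ) (z ζ : ℂ) : ℂ :=
  Complex.exp (α * (starRingEnd ℂ) z * ζ - α * ‖z‖ ^ 2 / 2)

theorem differentiable_gaussTest (α : ℝ) (z : ℂ) : Differentiable ℂ (gaussTest α z) := by
  unfold gaussTest
  fun_prop

theorem norm_gaussTest_sq (α : ℝ) (z ζ : ℂ) :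
    ‖gaussTest α z ζ‖ ^ 2 = Real.exp (α * ‖ζ‖ ^ 2 - α * ‖ζ - z‖ ^ 2) := by
  rw [gaussTest, Complex.norm_exp, ← Real.exp_nat_mul]
  congr 1
  have h : (α : ℂ) * (‖z‖ : ℂ) ^ 2 / 2 = ((α * ‖z‖ ^ 2 / 2 : ℝ) : ℂ) := by push_cast; rfl
  rw [h]
  simp only [Complex.sq_norm, Complex.normSq_apply, Complex.mul_re, Complex.mul_im,
    Complex.sub_re, Complex.sub_im, Complex.conj_re, Complex.conj_im,
    Complex.ofReal_re, Complex.ofReal_im]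
  push_cast
  ring

/-- Completing the square turns the test function into a bump translated to z, which is what
localises the averages. -/
theorem fockDensity_gaussTest (α : ℝ) (z ζ : ℂ) :
    fockDensity α (gaussTest α z) ζ = ENNReal.ofReal (Real.exp (-α * ‖ζ - z‖ ^ 2)) := by
  rw [fockDensity, ← ofReal_norm, ← ENNReal.ofReal_pow (norm_nonneg _), norm_gaussTest_sq,
    ← ENNReal.ofReal_mul (by positivity), ← Real.exp_add]
  congr 2
  ring

/-! ### Carleson embedding and averages of a measure -/

section LocalAp

variable {p R : ℝ} {A : ℝ≥0∞} {W : Measure ℂ}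

theorem IsLocalAp.inv_measure_ball_le [IsLocallyFiniteMeasure W] [W.IsOpenPosMeasure]
    (h : IsLocalAp p R A W) (hp : 1 < p) (hR : 0 < R) (hA : A ≠ ⊤)
    {r : ℝ} (hr : 0 < r) (hrR : r ≤ R) :
    ∃ C : ℝ≥0∞, C ≠ ⊤ ∧ ∀ z, (W (Metric.ball z r))⁻¹ ≤ C * (W (Metric.ball z R))⁻¹ := by
  obtain ⟨C, hC, h1⟩ := h.measure_ball_le hp hA hr hrR
  exact ⟨C, hC, fun z => ENNReal_inv_le (measure_ball_ne_zero W z hR) hC (h1 z)⟩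

theorem IsLocalAp.inv_measure_ball_le_of_dist_le [IsLocallyFiniteMeasure W] [W.IsOpenPosMeasure]
    (h : IsLocalAp p R A W) (hp : 1 < p) (hR : 0 < R) (hA : A ≠ ⊤) :
    ∃ C : ℝ≥0∞, C ≠ ⊤ ∧ ∀ z z', dist z z' ≤ R / 2 →
      (W (Metric.ball z R))⁻¹ ≤ C * (W (Metric.ball z' R))⁻¹ := by
  obtain ⟨C, hC, h1⟩ := h.measure_ball_le_of_dist_le hp hR hA
  exact ⟨C, hC, fun z z' hd => ENNReal_inv_le (measure_ball_ne_zero W z' hR) hC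
    (h1 z' z (by rwa [dist_comm]))⟩

/-- The pointwise estimate is integrated against μ and the order exchanged; the integral over ζ ∈
D(η,r) then produces μ(D(η,r)). The bound r ≤ R/2 allows W(D(ζ,R)) to be replaced by W(D(η,R)),
which is at least W(D(η,r)). -/
theorem IsLocalAp.carleson [IsLocallyFiniteMeasure W] [W.IsOpenPosMeasure]
    (h : IsLocalAp p R A W) (hp : 1 < p) (hR : 0 < R) (hA : A ≠ ⊤) {α : ℝ} (hα : 0 < α)
    {r : ℝ} (hr : 0 < r) (hrR : r ≤ R / 2) :
    ∃ C : ℝ≥0∞, C ≠ ⊤ ∧ ∀ (μ : Measure ℂ) [SFinite μ] (F : ℂ → ℂ), Differentiable ℂ F →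
      ∫⁻ ζ, fockDensity α F ζ ∂μ ≤
        C * ∫⁻ η, μ (Metric.ball η r) / W (Metric.ball η r) * fockDensity α F η ∂W := by
  obtain ⟨C₁, hC₁, h1⟩ := h.pointwise_le hp hA α hα hr (by linarith)
  obtain ⟨C₂, hC₂, h2⟩ := h.inv_measure_ball_le_of_dist_le hp hR hA
  refine ⟨C₁ * C₂, ENNReal.mul_ne_top hC₁ hC₂, fun μ _ F hF => ?_⟩
  have hFm := measurable_fockDensity α hF.continuous
  have hqm : Measurable fun ζ => (W (Metric.ball ζ R))⁻¹ := (measurable_measure_ball W R).inv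
  calc ∫⁻ ζ, fockDensity α F ζ ∂μ
      ≤ ∫⁻ ζ, ∫⁻ η in Metric.ball ζ r, C₁ * (W (Metric.ball ζ R))⁻¹ * fockDensity α F η ∂W ∂μ := by
        refine lintegral_mono fun ζ => ?_
        have h0 := measure_ball_ne_zero W ζ hR
        have ht := measure_ball_ne_top W ζ R
        rw [lintegral_const_mul _ hFm, mul_comm C₁, mul_assoc]
        exact ENNReal_le_inv_mul h0 ht (h1 F hF ζ)
    _ = ∫⁻ η, ∫⁻ ζ in Metric.ball η r, C₁ * (W (Metric.ball ζ R))⁻¹ * fockDensity α F η ∂μ ∂W := by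
        refine lintegral_ball_swap μ W r ?_
        exact ((hqm.comp measurable_fst).const_mul C₁).mul (hFm.comp measurable_snd)
    _ ≤ ∫⁻ η, C₁ * C₂ * (μ (Metric.ball η r) / W (Metric.ball η r) * fockDensity α F η) ∂W := by
        refine lintegral_mono fun η => ?_
        have h3 : ∫⁻ ζ in Metric.ball η r, C₁ * (W (Metric.ball ζ R))⁻¹ * fockDensity α F η ∂μ ≤
            ∫⁻ ζ in Metric.ball η r,
              C₁ * (C₂ * (W (Metric.ball η R))⁻¹) * fockDensity α F η ∂μ := by
          refine setLIntegral_mono' measurableSet_ball fun ζ hζ => ?_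
          gcongr
          exact h2 ζ η ((Metric.mem_ball.1 hζ).le.trans hrR)
        refine h3.trans ?_
        rw [setLIntegral_const]
        calc _ = C₁ * C₂ * (μ (Metric.ball η r) * (W (Metric.ball η R))⁻¹ *
              fockDensity α F η) := by ring
          _ ≤ _ := by
            rw [div_eq_mul_inv]
            gcongr
            linarith
    _ = _ := by
        refine lintegral_const_mul _ ?_
        exact ((measurable_measure_ball μ r).div (measurable_measure_ball W r)).mul hFm

/-- The bump at z is at least e^{-αr²} on D(z,r). -/
theorem IsLocalAp.measure_div_le_gaussTest [IsLocallyFiniteMeasure W] [W.IsOpenPosMeasure]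
    (h : IsLocalAp p R A W) (hp : 1 < p) (hR : 0 < R) (hA : A ≠ ⊤) {α : ℝ} (hα : 0 < α)
    {r : ℝ} (hr : 0 < r) (hrR : r ≤ R) :
    ∃ C : ℝ≥0∞, C ≠ ⊤ ∧ ∀ (μ : Measure ℂ) (z : ℂ), μ (Metric.ball z r) / W (Metric.ball z r) ≤
      C * ((W (Metric.ball z R))⁻¹ * ∫⁻ ζ, fockDensity α (gaussTest α z) ζ ∂μ) := by
  obtain ⟨C, hC, h1⟩ := h.inv_measure_ball_le hp hR hA hr hrR
  set e := ENNReal.ofReal (Real.exp (-α * r ^ 2)) with he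
  have he0 : e ≠ 0 := by simp [he, Real.exp_pos]
  have het : e ≠ ⊤ := ENNReal.ofReal_ne_top
  refine ⟨C * e⁻¹, ENNReal.mul_ne_top hC (ENNReal.inv_ne_top.2 he0), fun μ z => ?_⟩
  have h2 : e * μ (Metric.ball z r) ≤ ∫⁻ ζ, fockDensity α (gaussTest α z) ζ ∂μ := by
    rw [← setLIntegral_const]
    refine (setLIntegral_mono' measurableSet_ball fun ζ hζ => ?_).trans (setLIntegral_le_lintegral _ _)
    rw [fockDensity_gaussTest]
    refine ENNReal.ofReal_le_ofReal (Real.exp_le_exp.2 ?_)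
    rw [Metric.mem_ball, dist_eq_norm] at hζ
    have : ‖ζ - z‖ ^ 2 ≤ r ^ 2 := pow_le_pow_left₀ (norm_nonneg _) hζ.le 2
    nlinarith
  calc μ (Metric.ball z r) / W (Metric.ball z r)
      ≤ (e⁻¹ * ∫⁻ ζ, fockDensity α (gaussTest α z) ζ ∂μ) * (C * (W (Metric.ball z R))⁻¹) := by
        rw [div_eq_mul_inv]
        exact mul_le_mul' (ENNReal_le_inv_mul he0 het h2) (h1 z)
    _ = _ := by ring

/-- D(z,r/2) ⊆ D(η,r), while the weights of the discs are comparable. Halving the radius is the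
price for comparing averages at different centres. -/
theorem IsLocalAp.measure_div_le_of_mem_ball [IsLocallyFiniteMeasure W] [W.IsOpenPosMeasure]
    (h : IsLocalAp p R A W) (hp : 1 < p) (hR : 0 < R) (hA : A ≠ ⊤) {r : ℝ} (hr : 0 < r)
    (hrR : r ≤ R / 2) :
    ∃ C : ℝ≥0∞, C ≠ ⊤ ∧ ∀ (μ : Measure ℂ) (z η : ℂ), η ∈ Metric.ball z (r / 2) →
      μ (Metric.ball z (r / 2)) / W (Metric.ball z (r / 2)) ≤
        C * (μ (Metric.ball η r) / W (Metric.ball η r)) := by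
  obtain ⟨C₁, hC₁, h1⟩ := h.inv_measure_ball_le hp hR hA (half_pos hr) (by linarith)
  obtain ⟨C₂, hC₂, h2⟩ := h.inv_measure_ball_le_of_dist_le hp hR hA
  refine ⟨C₁ * C₂, ENNReal.mul_ne_top hC₁ hC₂, fun μ z η hη => ?_⟩
  rw [Metric.mem_ball] at hη
  have hsub : Metric.ball z (r / 2) ⊆ Metric.ball η r :=
    Metric.ball_subset_ball' (by rw [dist_comm]; linarith)
  have hsub' : Metric.ball η r ⊆ Metric.ball η R := Metric.ball_subset_ball (by linarith)
  calc μ (Metric.ball z (r / 2)) / W (Metric.ball z (r / 2))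
      ≤ μ (Metric.ball η r) * (C₁ * (C₂ * (W (Metric.ball η R))⁻¹)) := by
        rw [div_eq_mul_inv]
        refine mul_le_mul' (measure_mono hsub) ((h1 z).trans (mul_le_mul_right ?_ _))
        exact h2 z η (by rw [dist_comm]; linarith)
    _ ≤ μ (Metric.ball η r) * (C₁ * (C₂ * (W (Metric.ball η r))⁻¹)) := by gcongr
    _ = _ := by rw [div_eq_mul_inv]; ring

theorem IsLocalAp.measure_div_rpow_le_lintegral [IsLocallyFiniteMeasure W] [W.IsOpenPosMeasure]
    (h : IsLocalAp p R A W) (hp : 1 < p) (hR : 0 < R) (hA : A ≠ ⊤) {r : ℝ} (hr : 0 < r)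
    (hrR : r ≤ R / 2) {q : ℝ} (hq : 0 < q) :
    ∃ C : ℝ≥0∞, C ≠ ⊤ ∧ ∀ (μ : Measure ℂ) [SFinite μ] (z : ℂ),
      (μ (Metric.ball z (r / 2)) / W (Metric.ball z (r / 2))) ^ q ≤
        C * ∫⁻ η in Metric.ball z (r / 2), (μ (Metric.ball η r) / W (Metric.ball η r)) ^ q := by
  obtain ⟨C, hC, h1⟩ := h.measure_div_le_of_mem_ball hp hR hA hr hrR
  set V := volume (Metric.ball (0 : ℂ) (r / 2)) with hV
  have hV0 : V ≠ 0 := measure_ball_ne_zero volume 0 (half_pos hr)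
  have hVt : V ≠ ⊤ := measure_ball_ne_top volume 0 _
  refine ⟨V⁻¹ * C ^ q, ENNReal.mul_ne_top (ENNReal.inv_ne_top.2 hV0)
    (ENNReal.rpow_ne_top_of_nonneg hq.le hC), fun μ _ z => ?_⟩
  rw [mul_assoc]
  refine ENNReal_le_inv_mul hV0 hVt ?_
  rw [← lintegral_const_mul' _ _ (ENNReal.rpow_ne_top_of_nonneg hq.le hC), hV,
    ← volume_ball_eq z, mul_comm, ← setLIntegral_const]
  refine setLIntegral_mono' measurableSet_ball fun η hη => ?_
  rw [← ENNReal.mul_rpow_of_nonneg _ _ hq.le]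
  exact ENNReal.rpow_le_rpow (h1 μ z η hη) hq.le

/-- The measure dW(z)/W(D(z,R)) gives bounded mass to discs of radius r/2. Bounding the q-th power
at z by its local dA-integral at radius r and applying Tonelli therefore replaces it by dA. -/
theorem IsLocalAp.lintegral_measure_div_rpow_le [IsLocallyFiniteMeasure W] [W.IsOpenPosMeasure]
    (h : IsLocalAp p R A W) (hp : 1 < p) (hR : 0 < R) (hA : A ≠ ⊤) {r : ℝ} (hr : 0 < r)
    (hrR : r ≤ R / 2) {q : ℝ} (hq : 0 < q) :
    ∃ C : ℝ≥0∞, C ≠ ⊤ ∧ ∀ (μ : Measure ℂ) [SFinite μ],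
      ∫⁻ z, (μ (Metric.ball z (r / 2)) / W (Metric.ball z (r / 2))) ^ q *
        (W (Metric.ball z R))⁻¹ ∂W ≤
        C * ∫⁻ η, (μ (Metric.ball η r) / W (Metric.ball η r)) ^ q := by
  obtain ⟨C, hC, h1⟩ := h.measure_div_rpow_le_lintegral hp hR hA hr hrR hq
  obtain ⟨C₂, hC₂, h2⟩ := h.inv_measure_ball_le_of_dist_le hp hR hA
  refine ⟨C * C₂, ENNReal.mul_ne_top hC hC₂, fun μ _ => ?_⟩
  have hMm : Measurable fun η => (μ (Metric.ball η r) / W (Metric.ball η r)) ^ q :=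
    ((measurable_measure_ball μ r).div (measurable_measure_ball W r)).pow_const q
  have hqm : Measurable fun ζ => (W (Metric.ball ζ R))⁻¹ := (measurable_measure_ball W R).inv
  calc _ ≤ ∫⁻ z, ∫⁻ η in Metric.ball z (r / 2), C * (W (Metric.ball z R))⁻¹ *
        (μ (Metric.ball η r) / W (Metric.ball η r)) ^ q ∂volume ∂W := by
        refine lintegral_mono fun z => ?_
        rw [lintegral_const_mul _ hMm, mul_right_comm]
        exact mul_le_mul_left (h1 μ z) _
    _ = ∫⁻ η, ∫⁻ z in Metric.ball η (r / 2), C * (W (Metric.ball z R))⁻¹ *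
        (μ (Metric.ball η r) / W (Metric.ball η r)) ^ q ∂W := by
        refine lintegral_ball_swap W volume (r / 2) ?_
        exact ((hqm.comp measurable_fst).const_mul C).mul (hMm.comp measurable_snd)
    _ ≤ ∫⁻ η, C * C₂ * (μ (Metric.ball η r) / W (Metric.ball η r)) ^ q := by
        refine lintegral_mono fun η => ?_
        have h3 : ∫⁻ z in Metric.ball η (r / 2), C * (W (Metric.ball z R))⁻¹ *
            (μ (Metric.ball η r) / W (Metric.ball η r)) ^ q ∂W ≤
            ∫⁻ z in Metric.ball η (r / 2), C * (C₂ * (W (Metric.ball η R))⁻¹) *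
            (μ (Metric.ball η r) / W (Metric.ball η r)) ^ q ∂W := by
          refine setLIntegral_mono' measurableSet_ball fun z hz => ?_
          gcongr
          exact h2 z η (by linarith [Metric.mem_ball.1 hz])
        refine h3.trans ?_
        rw [setLIntegral_const]
        have h4 : (W (Metric.ball η R))⁻¹ * W (Metric.ball η (r / 2)) ≤ 1 := by
          rw [mul_comm, ← div_eq_mul_inv]
          refine ENNReal.div_le_of_le_mul ?_
          rw [one_mul]
          exact measure_mono (Metric.ball_subset_ball (by linarith))
        calc _ = C * C₂ * (μ (Metric.ball η r) / W (Metric.ball η r)) ^ q *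
              ((W (Metric.ball η R))⁻¹ * W (Metric.ball η (r / 2))) := by ring
          _ ≤ _ := mul_le_of_le_one_right' h4
    _ = _ := lintegral_const_mul _ hMm

/-- A finite measure gives small mass to balls of fixed radius far away. -/
theorem tendsto_measure_ball_cocompact (ν : Measure ℂ) [IsFiniteMeasure ν] (r : ℝ) :
    Tendsto (fun z => ν (Metric.ball z r)) (cocompact ℂ) (𝓝 0) := by
  rw [ENNReal.tendsto_nhds_zero]
  intro ε hε
  obtain ⟨K, hK, hKε⟩ := (isTightMeasureSet_iff_exists_isCompact_measure_compl_le.1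
    (isTightMeasureSet_singleton (μ := ν))) ε hε
  have hcomp : IsCompact (Metric.cthickening r K) := hK.cthickening
  filter_upwards [hcomp.compl_mem_cocompact] with z hz
  refine (measure_mono ?_).trans (hKε ν rfl)
  intro ζ hζ hζK
  exact hz (Metric.mem_cthickening_of_dist_le z ζ r K hζK (by rw [dist_comm]; exact (Metric.mem_ball.1 hζ).le))

/-- The q-th power of the average at radius r is the density of a finite measure, which gives little
mass to distant discs; these masses dominate the q-th powers of the averages at radius r/2. -/
theorem IsLocalAp.tendsto_measure_div [IsLocallyFiniteMeasure W] [W.IsOpenPosMeasure]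
    (h : IsLocalAp p R A W) (hp : 1 < p) (hR : 0 < R) (hA : A ≠ ⊤) {r : ℝ} (hr : 0 < r)
    (hrR : r ≤ R / 2) {q : ℝ} (hq : 0 < q) (μ : Measure ℂ) [SFinite μ]
    (hint : ∫⁻ η, (μ (Metric.ball η r) / W (Metric.ball η r)) ^ q < ⊤) :
    (∀ z, μ (Metric.ball z (r / 2)) / W (Metric.ball z (r / 2)) < ⊤) ∧
      Tendsto (fun z => μ (Metric.ball z (r / 2)) / W (Metric.ball z (r / 2)))
        (cocompact ℂ) (𝓝 0) := by
  obtain ⟨C, hC, h1⟩ := h.measure_div_rpow_le_lintegral hp hR hA hr hrR hq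
  constructor
  · intro z
    rw [← ENNReal.rpow_lt_top_iff_of_pos hq]
    exact ((h1 μ z).trans (mul_le_mul_right (setLIntegral_le_lintegral _ _) _)).trans_lt
      (ENNReal.mul_lt_top hC.lt_top hint)
  · set ν := volume.withDensity fun η => (μ (Metric.ball η r) / W (Metric.ball η r)) ^ q with hν
    have : IsFiniteMeasure ν := isFiniteMeasure_withDensity hint.ne
    have h2 := ENNReal.Tendsto.const_mul (tendsto_measure_ball_cocompact ν (r / 2))
      (Or.inr hC) (a := C)
    rw [mul_zero] at h2
    have h3 : Tendsto (fun z => (μ (Metric.ball z (r / 2)) / W (Metric.ball z (r / 2))) ^ q)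
        (cocompact ℂ) (𝓝 0) := by
      refine tendsto_of_tendsto_of_tendsto_of_le_of_le tendsto_const_nhds h2
        (fun _ => zero_le) fun z => ?_
      simp only [hν, withDensity_apply _ measurableSet_ball]
      exact h1 μ z
    have h4 := h3.ennrpow_const (1 / q)
    simp only [← ENNReal.rpow_mul, mul_one_div_cancel hq.ne', ENNReal.rpow_one] at h4
    rwa [ENNReal.zero_rpow_of_pos (by positivity)] at h4

end LocalAp

/-! ### The weighted Fock space as a Hilbert space of entire functions -/

section FockSpace

variable {α : ℝ} {w : ℂ → ℝ}

theorem measurable_gaussian (α : ℝ) :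
    Measurable fun z : ℂ => ENNReal.ofReal (Real.exp (-α * ‖z‖ ^ 2)) := by
  fun_prop

theorem IsWeight.fockMeasure_eq (hw : IsWeight w) (α : ℝ) :
    fockMeasure α w = (weightMeasure w).withDensity
      fun z => ENNReal.ofReal (Real.exp (-α * ‖z‖ ^ 2)) := by
  rw [weightMeasure, ← withDensity_mul₀ hw.aemeasurable (measurable_gaussian α).aemeasurable,
    fockMeasure]
  congr 1
  funext z
  rw [Pi.mul_apply, ENNReal.ofReal_mul (Real.exp_pos _).le, mul_comm]

theorem IsWeight.lintegral_fockMeasure (hw : IsWeight w) (α : ℝ) {g : ℂ → ℝ≥0∞}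
    (hg : Measurable g) : ∫⁻ z, g z ∂fockMeasure α w =
      ∫⁻ z, g z * ENNReal.ofReal (Real.exp (-α * ‖z‖ ^ 2)) ∂weightMeasure w := by
  rw [hw.fockMeasure_eq, lintegral_withDensity_eq_lintegral_mul _ (measurable_gaussian α) hg]
  simp [mul_comm]

theorem IsWeight.volume_absolutelyContinuous_fockMeasure (hw : IsWeight w) (α : ℝ) :
    volume ≪ fockMeasure α w := by
  refine hw.absolutelyContinuous.trans ?_
  rw [hw.fockMeasure_eq]
  refine withDensity_absolutelyContinuous' (measurable_gaussian α).aemeasurable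
    (ae_of_all _ fun z => ?_)
  simp [Real.exp_pos]

/-- Since w > 0 almost everywhere, the measure sees every open set; a class therefore has only one
entire representative, and the choice in `rep` is harmless. -/
theorem IsWeight.eq_of_ae_eq (hw : IsWeight w) {F G : ℂ → ℂ} (hF : Continuous F)
    (hG : Continuous G) (h : F =ᵐ[fockMeasure α w] G) : F = G :=
  Measure.eq_of_ae_eq ((hw.volume_absolutelyContinuous_fockMeasure α).ae_eq h) hF hG

/-- The entire function representing an element of the Fock space. -/
def rep (f : fockSpace α w) : ℂ → ℂ := Classical.choose f.2

theorem differentiable_rep (f : fockSpace α w) : Differentiable ℂ (rep f) :=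
  (Classical.choose_spec f.2).1

theorem coe_ae_eq_rep (f : fockSpace α w) :
    (f : Lp ℂ 2 (fockMeasure α w)) =ᵐ[fockMeasure α w] rep f :=
  (Classical.choose_spec f.2).2

theorem IsWeight.rep_eq (hw : IsWeight w) {f : fockSpace α w} {F : ℂ → ℂ}
    (hF : Differentiable ℂ F) (h : (f : Lp ℂ 2 (fockMeasure α w)) =ᵐ[fockMeasure α w] F) :
    rep f = F :=
  hw.eq_of_ae_eq (differentiable_rep f).continuous hF.continuous ((coe_ae_eq_rep f).symm.trans h)

theorem IsWeight.rep_add (hw : IsWeight w) (f g : fockSpace α w) :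
    rep (f + g) = rep f + rep g := by
  refine hw.rep_eq ((differentiable_rep f).add (differentiable_rep g)) ?_
  exact (Lp.coeFn_add _ _).trans ((coe_ae_eq_rep f).add (coe_ae_eq_rep g))

theorem IsWeight.rep_sub (hw : IsWeight w) (f g : fockSpace α w) :
    rep (f - g) = rep f - rep g := by
  refine hw.rep_eq ((differentiable_rep f).sub (differentiable_rep g)) ?_
  exact (Lp.coeFn_sub _ _).trans ((coe_ae_eq_rep f).sub (coe_ae_eq_rep g))

theorem IsWeight.rep_smul (hw : IsWeight w) (c : ℂ) (f : fockSpace α w) :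
    rep (c • f) = c • rep f := by
  refine hw.rep_eq ((differentiable_rep f).const_smul c) ?_
  exact (Lp.coeFn_smul _ _).trans ((coe_ae_eq_rep f).const_smul c)

theorem eq_zero_of_rep_eq_zero {f : fockSpace α w} (h : ∀ z, rep f z = 0) : f = 0 := by
  refine Subtype.ext (Lp.ext ?_)
  refine (coe_ae_eq_rep f).trans (EventuallyEq.trans ?_ (Lp.coeFn_zero _ _ _).symm)
  exact ae_of_all _ h

theorem eLpNorm_two_sq (m : Measure ℂ) (F : ℂ → ℂ) :
    eLpNorm F 2 m ^ 2 = ∫⁻ z, ‖F z‖ₑ ^ 2 ∂m := by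
  have := eLpNorm_nnreal_pow_eq_lintegral (f := F) (μ := m) (p := 2) two_ne_zero
  simpa using this

theorem IsWeight.eLpNorm_sq (hw : IsWeight w) {F : ℂ → ℂ} (hF : Continuous F) :
    eLpNorm F 2 (fockMeasure α w) ^ 2 = ∫⁻ z, fockDensity α F z ∂weightMeasure w := by
  rw [eLpNorm_two_sq, hw.lintegral_fockMeasure α (hF.enorm.measurable.pow_const 2)]
  rfl

theorem IsWeight.enorm_sq (hw : IsWeight w) (f : fockSpace α w) :
    ‖f‖ₑ ^ 2 = ∫⁻ z, fockDensity α (rep f) z ∂weightMeasure w := by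
  rw [← hw.eLpNorm_sq (differentiable_rep f).continuous, ← eLpNorm_congr_ae (coe_ae_eq_rep f),
    ← Lp.enorm_def]
  rfl

theorem IsWeight.exists_rep_eq (hw : IsWeight w) {F : ℂ → ℂ} (hF : Differentiable ℂ F)
    (h : ∫⁻ z, fockDensity α F z ∂weightMeasure w ≠ ⊤) : ∃ f : fockSpace α w, rep f = F := by
  rw [← hw.eLpNorm_sq hF.continuous] at h
  have hm : MemLp F 2 (fockMeasure α w) :=
    ⟨hF.continuous.aestronglyMeasurable, by
      rw [lt_top_iff_ne_top]
      intro h'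
      simp [h'] at h⟩
  exact ⟨⟨hm.toLp F, F, hF, hm.coeFn_toLp⟩, hw.rep_eq hF hm.coeFn_toLp⟩

/-- Norm bounded point evaluations, locally uniformly. -/
def HasBoundedEvaluations (α : ℝ) (w : ℂ → ℝ) : Prop :=
  ∀ ρ : ℝ, ∃ B : ℝ, 0 ≤ B ∧ ∀ (f : fockSpace α w) (z : ℂ), ‖z‖ ≤ ρ → ‖rep f z‖ ≤ B * ‖f‖

theorem norm_le_of_enorm_sq_le {E E' : Type*} [SeminormedAddCommGroup E] [SeminormedAddCommGroup E']
    {x : E} {y : E'} {C : ℝ≥0∞} (hC : C ≠ ⊤) (h : ‖x‖ₑ ^ 2 ≤ C * ‖y‖ₑ ^ 2) :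
    ‖x‖ ≤ Real.sqrt C.toReal * ‖y‖ := by
  refine le_of_sq_le_sq ?_ (by positivity)
  rw [mul_pow, Real.sq_sqrt ENNReal.toReal_nonneg]
  have h1 := ENNReal.toReal_mono (ENNReal.mul_ne_top hC (by simp)) h
  simpa using h1

/-- The local pointwise estimate, with W(D(z,R)) compared to W(D(0,R)) by the growth bound and
e^{α|z|²} bounded on the disc |z| ≤ ρ. -/
theorem IsLocalAp.hasBoundedEvaluations {p R : ℝ} {A : ℝ≥0∞} (hw : IsWeight w)
    (h : IsLocalAp p R A (weightMeasure w)) (hp : 1 < p) (hR : 0 < R) (hA : A ≠ ⊤) (hα : 0 < α) :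
    HasBoundedEvaluations α w := by
  intro ρ
  have := hw.isLocallyFiniteMeasure
  have := hw.isOpenPosMeasure
  obtain ⟨C, hC, h1⟩ := h.pointwise_le hp hA α hα hR le_rfl
  obtain ⟨K, κ, hK, hκ, h2⟩ := h.growth hp hR hA
  set W := weightMeasure w with hW
  have hq0 : W (Metric.ball 0 R) ≠ 0 := measure_ball_ne_zero W 0 hR
  set D : ℝ≥0∞ := ENNReal.ofReal (Real.exp (α * ρ ^ 2)) *
    ((W (Metric.ball 0 R))⁻¹ * (ENNReal.ofReal (K * Real.exp (κ * ρ)) * C)) with hD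
  have hDt : D ≠ ⊤ := ENNReal.mul_ne_top ENNReal.ofReal_ne_top (ENNReal.mul_ne_top
    (ENNReal.inv_ne_top.2 hq0) (ENNReal.mul_ne_top ENNReal.ofReal_ne_top hC))
  refine ⟨Real.sqrt D.toReal, Real.sqrt_nonneg _, fun f z hz => norm_le_of_enorm_sq_le hDt ?_⟩
  have h3 : W (Metric.ball 0 R) * fockDensity α (rep f) z ≤
      ENNReal.ofReal (K * Real.exp (κ * ρ)) * C * ‖f‖ₑ ^ 2 := by
    calc W (Metric.ball 0 R) * fockDensity α (rep f) z
        ≤ ENNReal.ofReal (K * Real.exp (κ * ρ)) * W (Metric.ball z R) *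
          fockDensity α (rep f) z := by
          refine mul_le_mul_left ((h2 z 0).trans ?_) _
          gcongr
          simpa using hz
      _ ≤ ENNReal.ofReal (K * Real.exp (κ * ρ)) * (C * ∫⁻ ζ, fockDensity α (rep f) ζ ∂W) := by
          rw [mul_assoc]
          refine mul_le_mul_right ((h1 _ (differentiable_rep f) z).trans ?_) _
          exact mul_le_mul_right (setLIntegral_le_lintegral _ _) _
      _ = _ := by rw [hw.enorm_sq, mul_assoc]
  have h4 := ENNReal_le_inv_mul hq0 (measure_ball_ne_top W 0 R) h3
  have h5 : ‖rep f z‖ₑ ^ 2 ≤ ENNReal.ofReal (Real.exp (α * ρ ^ 2)) * fockDensity α (rep f) z := by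
    rw [fockDensity, mul_left_comm, ← ENNReal.ofReal_mul (by positivity), ← Real.exp_add]
    refine le_mul_of_one_le_right' ?_
    rw [ENNReal.one_le_ofReal, Real.one_le_exp_iff]
    have : ‖z‖ ^ 2 ≤ ρ ^ 2 := pow_le_pow_left₀ (norm_nonneg _) hz 2
    nlinarith
  refine h5.trans ((mul_le_mul_right h4 _).trans (le_of_eq ?_))
  rw [hD]
  ring

/-- Point evaluation as a bounded functional. -/
def evalCLM (hw : IsWeight w) (hb : HasBoundedEvaluations α w) (z : ℂ) : fockSpace α w →L[ℂ] ℂ :=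
  LinearMap.mkContinuous
    { toFun := fun f => rep f z
      map_add' := fun f g => by rw [hw.rep_add]; rfl
      map_smul' := fun c f => by rw [hw.rep_smul]; rfl }
    (Classical.choose (hb ‖z‖)) fun f => (Classical.choose_spec (hb ‖z‖)).2 f z le_rfl

theorem evalCLM_apply (hw : IsWeight w) (hb : HasBoundedEvaluations α w) (z : ℂ)
    (f : fockSpace α w) : evalCLM hw hb z f = rep f z := rfl

/-- A norm limit of entire functions is also their locally uniform limit, hence entire; an almost
everywhere convergent subsequence identifies it with the L² limit. -/
theorem HasBoundedEvaluations.completeSpace (hb : HasBoundedEvaluations α w) (hw : IsWeight w) :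
    CompleteSpace (fockSpace α w) := by
  suffices hcl : IsClosed (fockSpace α w : Set (Lp ℂ 2 (fockMeasure α w))) from
    hcl.completeSpace_coe
  refine IsSeqClosed.isClosed fun u g hu hug => ?_
  set f : ℕ → fockSpace α w := fun n => ⟨u n, hu n⟩ with hf
  have hcau : CauchySeq f := by
    rw [cauchySeq_iff_tendsto_dist_atTop_0]
    exact (cauchySeq_iff_tendsto_dist_atTop_0 (u := u)).1 hug.cauchySeq
  have hpt : ∀ z, ∃ c, Tendsto (fun n => rep (f n) z) atTop (𝓝 c) := fun z =>
    cauchySeq_tendsto_of_complete ((evalCLM hw hb z).uniformContinuous.comp_cauchySeq hcau)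
  choose F hF using hpt
  have hloc : TendstoLocallyUniformlyOn (fun n => rep (f n)) F atTop Set.univ := by
    rw [tendstoLocallyUniformlyOn_iff_forall_isCompact isOpen_univ]
    intro K _ hK
    obtain ⟨ρ, hρ⟩ := hK.isBounded.subset_closedBall 0
    obtain ⟨B, hB0, hB⟩ := hb ρ
    refine UniformCauchySeqOn.tendstoUniformlyOn_of_tendsto ?_ fun z _ => hF z
    rw [Metric.uniformCauchySeqOn_iff]
    intro ε hε
    obtain ⟨N, hN⟩ := Metric.cauchySeq_iff.1 hcau (ε / (B + 1)) (by positivity)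
    refine ⟨N, fun m hm n hn z hz => ?_⟩
    have h1 := hB (f m - f n) z (by simpa using hρ hz)
    rw [hw.rep_sub, Pi.sub_apply, ← dist_eq_norm, ← dist_eq_norm] at h1
    have h2 := hN m hm n hn
    rw [lt_div_iff₀ (by positivity)] at h2
    have h3 : (0 : ℝ) ≤ dist (f m) (f n) := dist_nonneg
    nlinarith
  have hFd : Differentiable ℂ F := by
    rw [← differentiableOn_univ]
    exact hloc.differentiableOn
      (Eventually.of_forall fun n => (differentiable_rep (f n)).differentiableOn) isOpen_univ
  refine ⟨F, hFd, ?_⟩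
  have hns' : ∃ ns : ℕ → ℕ, StrictMono ns ∧ ∀ᵐ x ∂fockMeasure α w,
      Tendsto (fun i => (u (ns i) : ℂ → ℂ) x) atTop (𝓝 ((g : ℂ → ℂ) x)) :=
    (tendstoInMeasure_of_tendsto_Lp hug).exists_seq_tendsto_ae
  obtain ⟨ns, hmono, hns⟩ := hns'
  have hall : ∀ᵐ x ∂fockMeasure α w, ∀ n, (u n : ℂ → ℂ) x = rep (f n) x :=
    ae_all_iff.2 fun n => coe_ae_eq_rep (f n)
  filter_upwards [hns, hall] with x hx hx'
  refine tendsto_nhds_unique hx ?_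
  simp only [hx']
  exact (hF x).comp hmono.tendsto_atTop

theorem HasBoundedEvaluations.lipschitz (hb : HasBoundedEvaluations α w) (ρ : ℝ) :
    ∃ L : ℝ, 0 ≤ L ∧ ∀ (f : fockSpace α w) (z z' : ℂ), ‖z‖ ≤ ρ → ‖z'‖ ≤ ρ →
      ‖rep f z - rep f z'‖ ≤ L * ‖f‖ * ‖z - z'‖ := by
  -- The Cauchy estimate for the derivative uses unit circles about points of the disc of radius ρ.
  obtain ⟨B, hB0, hB⟩ := hb (ρ + 1)
  refine ⟨B, hB0, fun f z z' hz hz' => ?_⟩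
  have hd := differentiable_rep f
  refine Convex.norm_image_sub_le_of_norm_deriv_le (s := Metric.closedBall (0 : ℂ) ρ)
    (fun x _ => hd x) (fun x hx => ?_) (convex_closedBall _ _) (by simpa using hz') (by simpa using hz)
  have := Complex.norm_deriv_le_of_forall_mem_sphere_norm_le (c := x) (f := rep f) one_pos
    hd.diffContOnCl (C := B * ‖f‖) (fun y hy => hB f y ?_)
  · simpa using this
  · have h1 : ‖x‖ ≤ ρ := by simpa using hx
    have h2 : ‖y - x‖ = 1 := by simpa [dist_eq_norm] using hy
    calc ‖y‖ = ‖x + (y - x)‖ := by ring_nf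
      _ ≤ ρ + 1 := (norm_add_le _ _).trans (by linarith)

/-! ### Weighted composition operators and the pull-back measure -/

theorem IsWeight.sFinite_pullbackMeasure (w : ℂ → ℝ) (φ ψ : ℂ → ℂ) :
    SFinite (pullbackMeasure α w φ ψ) := by
  unfold pullbackMeasure
  infer_instance

/-- The factor e^{α|φ|²} in the pull-back measure cancels the Gaussian evaluated at φ(z), leaving
e^{-α|z|²}. This turns norms of the operator into integrals against μ. -/
theorem IsWeight.lintegral_pullbackMeasure (hw : IsWeight w) {φ ψ F : ℂ → ℂ}
    (hφ : Continuous φ) (hψ : Continuous ψ) (hF : Continuous F) :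
    ∫⁻ ζ, fockDensity α F ζ ∂pullbackMeasure α w φ ψ =
      ∫⁻ z, fockDensity α (fun z => ψ z * F (φ z)) z ∂weightMeasure w := by
  have hFm := measurable_fockDensity α hF
  have hm : Measurable fun z => ENNReal.ofReal
      (‖ψ z‖ ^ 2 * Real.exp (-α * (‖z‖ ^ 2 - ‖φ z‖ ^ 2))) := by
    refine (Continuous.measurable ?_).ennreal_ofReal
    fun_prop
  have he : (volume.withDensity fun z => ENNReal.ofReal
      (‖ψ z‖ ^ 2 * Real.exp (-α * (‖z‖ ^ 2 - ‖φ z‖ ^ 2)) * w z)) =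
      (weightMeasure w).withDensity fun z => ENNReal.ofReal
        (‖ψ z‖ ^ 2 * Real.exp (-α * (‖z‖ ^ 2 - ‖φ z‖ ^ 2))) := by
    rw [weightMeasure, ← withDensity_mul₀ hw.aemeasurable hm.aemeasurable]
    congr 1
    funext z
    rw [Pi.mul_apply, ENNReal.ofReal_mul (by positivity), mul_comm]
  rw [pullbackMeasure, lintegral_map hFm hφ.measurable, he,
    lintegral_withDensity_eq_lintegral_mul _ hm (g := fun z => fockDensity α F (φ z)) (hFm.comp hφ.measurable)]
  refine lintegral_congr fun z => ?_
  simp only [Pi.mul_apply, fockDensity, enorm_mul, mul_pow]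
  rw [ENNReal.ofReal_mul (by positivity), ENNReal.ofReal_pow (norm_nonneg _), ofReal_norm]
  have hE : ENNReal.ofReal (Real.exp (-α * ‖z‖ ^ 2)) =
      ENNReal.ofReal (Real.exp (-α * (‖z‖ ^ 2 - ‖φ z‖ ^ 2))) *
        ENNReal.ofReal (Real.exp (-α * ‖φ z‖ ^ 2)) := by
    rw [← ENNReal.ofReal_mul (by positivity), ← Real.exp_add]
    congr 2
    ring
  rw [hE]
  ring

theorem IsWeightedComposition.rep_eq {φ ψ : ℂ → ℂ} {T : fockSpace α w →L[ℂ] fockSpace α w}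
    (hT : IsWeightedComposition α w φ ψ T) (hw : IsWeight w) (hφ : Differentiable ℂ φ)
    (hψ : Differentiable ℂ ψ) (f : fockSpace α w) :
    rep (T f) = fun z => ψ z * rep f (φ z) :=
  hw.rep_eq (hψ.mul ((differentiable_rep f).comp hφ))
    (hT f (rep f) (differentiable_rep f) (coe_ae_eq_rep f))

theorem IsWeightedComposition.enorm_sq {φ ψ : ℂ → ℂ} {T : fockSpace α w →L[ℂ] fockSpace α w}
    (hT : IsWeightedComposition α w φ ψ T) (hw : IsWeight w) (hφ : Differentiable ℂ φ)
    (hψ : Differentiable ℂ ψ) (f : fockSpace α w) :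
    ‖T f‖ₑ ^ 2 = ∫⁻ ζ, fockDensity α (rep f) ζ ∂pullbackMeasure α w φ ψ := by
  rw [hw.enorm_sq, hT.rep_eq hw hφ hψ, hw.lintegral_pullbackMeasure hφ.continuous hψ.continuous
    (differentiable_rep f).continuous]

theorem IsWeight.exists_isWeightedComposition (hw : IsWeight w) {φ ψ : ℂ → ℂ}
    (hφ : Differentiable ℂ φ) (hψ : Differentiable ℂ ψ) {C : ℝ≥0∞} (hC : C ≠ ⊤)
    (h : ∀ F : ℂ → ℂ, Differentiable ℂ F → ∫⁻ ζ, fockDensity α F ζ ∂pullbackMeasure α w φ ψ ≤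
      C * ∫⁻ ζ, fockDensity α F ζ ∂weightMeasure w) :
    ∃ T : fockSpace α w →L[ℂ] fockSpace α w, IsWeightedComposition α w φ ψ T := by
  have hd : ∀ f : fockSpace α w, Differentiable ℂ fun z => ψ z * rep f (φ z) := fun f =>
    hψ.mul ((differentiable_rep f).comp hφ)
  have hle : ∀ f : fockSpace α w,
      ∫⁻ z, fockDensity α (fun z => ψ z * rep f (φ z)) z ∂weightMeasure w ≤ C * ‖f‖ₑ ^ 2 := by
    intro f
    rw [← hw.lintegral_pullbackMeasure hφ.continuous hψ.continuous
      (differentiable_rep f).continuous, hw.enorm_sq]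
    exact h _ (differentiable_rep f)
  have hex : ∀ f : fockSpace α w, ∃ g : fockSpace α w, rep g = fun z => ψ z * rep f (φ z) :=
    fun f => hw.exists_rep_eq (hd f) ((hle f).trans_lt
      (ENNReal.mul_lt_top hC.lt_top (by simp))).ne
  choose S hS using hex
  have hinj : ∀ f g : fockSpace α w, rep f = rep g → f = g := fun f g hfg => by
    rw [← sub_eq_zero]
    exact eq_zero_of_rep_eq_zero fun z => by rw [hw.rep_sub, hfg]; simp
  let S' : fockSpace α w →ₗ[ℂ] fockSpace α w :=
    { toFun := S
      map_add' := fun f g => hinj _ _ (by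
        rw [hw.rep_add, hS, hS, hS, hw.rep_add]
        funext z
        simp [mul_add])
      map_smul' := fun c f => hinj _ _ (by
        rw [RingHom.id_apply, hw.rep_smul, hS, hS, hw.rep_smul]
        funext z
        simp [mul_left_comm]) }
  refine ⟨S'.mkContinuous (Real.sqrt C.toReal) fun f => norm_le_of_enorm_sq_le hC ?_, ?_⟩
  · change ‖S f‖ₑ ^ 2 ≤ _
    rw [hw.enorm_sq, hS]
    exact hle f
  · intro f F hF hfF
    have h1 : rep f = F := hw.rep_eq hF hfF
    have h2 := coe_ae_eq_rep (S f)
    rw [hS, h1] at h2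
    exact h2

end FockSpace

/-! ### Compact operators and canonical decompositions in Hilbert space -/

section Hilbert

variable {H : Type*} [NormedAddCommGroup H] [InnerProductSpace ℂ H]

/-- The vectors T uᵢ lie in a compact set, and any limit point is annihilated by the separating
family E, so it is 0. With point evaluations for E, no weak convergence of uᵢ has to be discussed.
-/
theorem tendsto_zero_of_isCompactOperator {ι κ : Type*} {T : H →L[ℂ] H} (hT : IsCompactOperator T)
    {l : Filter ι} {u : ι → H} {C : ℝ} (hu : ∀ i, ‖u i‖ ≤ C) (E : κ → H →L[ℂ] ℂ)
    (hE : ∀ x, (∀ k, E k x = 0) → x = 0)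
    (hlim : ∀ k, Tendsto (fun i => E k (T (u i))) l (𝓝 0)) :
    Tendsto (fun i => T (u i)) l (𝓝 0) := by
  obtain ⟨K, hK, hTK⟩ := IsCompactOperator.image_closedBall_subset_compact
    (f := (T : H →ₗ[ℂ] H)) hT C
  rw [tendsto_iff_ultrafilter]
  intro U hU
  have hmem : ∀ i, T (u i) ∈ K := fun i => hTK ⟨u i, by simpa using hu i, rfl⟩
  obtain ⟨x, -, hx⟩ := hK.ultrafilter_le_nhds (U.map fun i => T (u i))
    (le_principal_iff.2 (by
      rw [Ultrafilter.coe_map, mem_map]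
      exact univ_mem' hmem))
  have hx' : Tendsto (fun i => T (u i)) U (𝓝 x) := hx
  have h0 : x = 0 := hE x fun k =>
    tendsto_nhds_unique (((E k).continuous.tendsto x).comp hx') ((hlim k).mono_left hU)
  rwa [h0] at hx'

/-- An orthonormal family in which some vectors may be replaced by `0`. -/
structure IsPartialOrthonormal {ι : Type*} (e : ι → H) : Prop where
  eq_zero_or_norm_eq_one : ∀ k, e k = 0 ∨ ‖e k‖ = 1
  inner_eq_zero : ∀ j k, j ≠ k → inner ℂ (e j) (e k) = 0

namespace IsPartialOrthonormal

variable {ι : Type*} {e : ι → H}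

theorem norm_le_one (h : IsPartialOrthonormal e) (k : ι) : ‖e k‖ ≤ 1 := by
  rcases h.eq_zero_or_norm_eq_one k with h | h <;> simp [h]

theorem inner_smul_self (h : IsPartialOrthonormal e) (k : ι) (x : H) :
    inner ℂ (e k) x * inner ℂ (e k) (e k) = inner ℂ (e k) x := by
  rcases h.eq_zero_or_norm_eq_one k with h | h
  · simp [h]
  · rw [inner_self_eq_norm_sq_to_K, h]; simp

theorem norm_sum_sq (h : IsPartialOrthonormal e) (F : Finset ι) (c : ι → ℂ) :
    ‖∑ k ∈ F, c k • e k‖ ^ 2 = ∑ k ∈ F, ‖c k‖ ^ 2 * ‖e k‖ ^ 2 := by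
  classical
  induction F using Finset.induction_on with
  | empty => simp
  | insert a F ha ih =>
    suffices h0 : inner ℂ (c a • e a) (∑ k ∈ F, c k • e k) = 0 by
      rw [Finset.sum_insert ha, Finset.sum_insert ha, ← ih, ← mul_pow, ← norm_smul, sq, sq, sq]
      exact norm_add_sq_eq_norm_sq_add_norm_sq_of_inner_eq_zero _ _ h0
    rw [inner_sum]
    refine Finset.sum_eq_zero fun k hk => ?_
    rw [inner_smul_left, inner_smul_right, h.inner_eq_zero a k (by rintro rfl; exact ha hk)]
    simp

theorem norm_sum_sq_le (h : IsPartialOrthonormal e) (F : Finset ι) (c : ι → ℂ) :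
    ‖∑ k ∈ F, c k • e k‖ ^ 2 ≤ ∑ k ∈ F, ‖c k‖ ^ 2 := by
  rw [h.norm_sum_sq]
  refine Finset.sum_le_sum fun k _ => mul_le_of_le_one_right (by positivity) ?_
  exact pow_le_one₀ (norm_nonneg _) (h.norm_le_one k)

theorem inner_sub_sum (h : IsPartialOrthonormal e) (F : Finset ι) (x : H) {j : ι} (hj : j ∈ F) :
    inner ℂ (e j) (x - ∑ k ∈ F, inner ℂ (e k) x • e k) = 0 := by
  rw [inner_sub_right, inner_sum, Finset.sum_eq_single j]
  · rw [inner_smul_right, h.inner_smul_self, sub_self]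
  · intro k _ hk
    rw [inner_smul_right, h.inner_eq_zero j k hk.symm, mul_zero]
  · exact fun h' => absurd hj h'

theorem norm_sq_eq (h : IsPartialOrthonormal e) (F : Finset ι) (x : H) :
    ‖x‖ ^ 2 = ∑ k ∈ F, ‖inner ℂ (e k) x‖ ^ 2 + ‖x - ∑ k ∈ F, inner ℂ (e k) x • e k‖ ^ 2 := by
  set y := ∑ k ∈ F, (inner ℂ (e k) x : ℂ) • e k with hy
  have h1 : inner ℂ y (x - y) = 0 := by
    rw [hy, sum_inner]
    refine Finset.sum_eq_zero fun k hk => ?_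
    rw [inner_smul_left, h.inner_sub_sum F x hk, mul_zero]
  have h2 : ‖y‖ ^ 2 = ∑ k ∈ F, ‖(inner ℂ (e k) x : ℂ)‖ ^ 2 := by
    rw [hy, h.norm_sum_sq]
    refine Finset.sum_congr rfl fun k _ => ?_
    rcases h.eq_zero_or_norm_eq_one k with h | h <;> simp [h]
  rw [← h2]
  have h3 := norm_add_sq_eq_norm_sq_add_norm_sq_of_inner_eq_zero y (x - y) h1
  rw [add_sub_cancel] at h3
  nlinarith

theorem norm_sub_sum_le (h : IsPartialOrthonormal e) (F : Finset ι) (x : H) :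
    ‖x - ∑ k ∈ F, inner ℂ (e k) x • e k‖ ≤ ‖x‖ := by
  refine le_of_sq_le_sq ?_ (norm_nonneg x)
  rw [h.norm_sq_eq F x]
  have : 0 ≤ ∑ k ∈ F, ‖(inner ℂ (e k) x : ℂ)‖ ^ 2 := by positivity
  linarith

theorem tsum_enorm_inner_sq_le (h : IsPartialOrthonormal e) (x : H) :
    ∑' k, ‖(inner ℂ (e k) x : ℂ)‖ₑ ^ 2 ≤ ‖x‖ₑ ^ 2 := by
  rw [ENNReal.tsum_eq_iSup_sum]
  refine iSup_le fun F => ?_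
  have h1 : ∑ k ∈ F, ‖(inner ℂ (e k) x : ℂ)‖ ^ 2 ≤ ‖x‖ ^ 2 := by
    rw [h.norm_sq_eq F x]
    exact le_add_of_nonneg_right (by positivity)
  have h2 := ENNReal.ofReal_le_ofReal h1
  rw [ENNReal.ofReal_sum_of_nonneg fun _ _ => by positivity] at h2
  simpa only [ENNReal.ofReal_pow (norm_nonneg _), ofReal_norm] using h2

end IsPartialOrthonormal

/-- For S ≠ 0, the self-adjoint operator S*S has a spectral value of modulus ‖S‖², which is an
eigenvalue by compactness; e is a unit eigenvector. The value e = 0 is reserved for S = 0, so that a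
recursion may continue after the operator is exhausted. -/
theorem exists_norm_attaining [CompleteSpace H] {S : H →L[ℂ] H} (hS : IsCompactOperator S) :
    ∃ e : H, (e = 0 ∨ ‖e‖ = 1) ∧ (e = 0 → S = 0) ∧ (S = 0 → e = 0) ∧
      ∀ y, (‖S‖ ^ 2 : ℂ) * inner ℂ e y = inner ℂ (S e) (S y) := by
  by_cases h0 : S = 0
  · exact ⟨0, Or.inl rfl, fun _ => h0, fun _ => rfl, fun y => by simp⟩
  set A := (ContinuousLinearMap.adjoint S) ∘L S with hA
  have hAc : IsCompactOperator A := hS.clm_comp (ContinuousLinearMap.adjoint S)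
  have hAn : ‖A‖ = ‖S‖ ^ 2 := by
    rw [hA, ContinuousLinearMap.norm_adjoint_comp_self, sq]
  have hAsa : IsSelfAdjoint A := by
    rw [ContinuousLinearMap.isSelfAdjoint_iff', hA, ContinuousLinearMap.adjoint_comp,
      ContinuousLinearMap.adjoint_adjoint]
  have hApos : 0 < ‖A‖ := by
    rw [hAn]
    have := norm_pos_iff.2 h0
    positivity
  have hne : Nontrivial H := by
    by_contra hcon
    rw [not_nontrivial_iff_subsingleton] at hcon
    exact h0 (Subsingleton.elim _ _)
  obtain ⟨c, hc, hcn⟩ := spectrum.exists_nnnorm_eq_spectralRadius A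
  have hrad : spectralRadius ℂ A = ‖A‖₊ := ContinuousLinearMap.spectralRadius_eq_nnnorm A hAsa
  rw [hrad, ENNReal.coe_inj] at hcn
  have hcn' : ‖c‖ = ‖S‖ ^ 2 := by
    rw [← hAn]
    exact congrArg NNReal.toReal hcn
  have hc0 : c ≠ 0 := by
    rintro rfl
    rw [norm_zero, ← hAn] at hcn'
    exact hApos.ne hcn'
  obtain ⟨v, hv⟩ := ((hAc.hasEigenvalue_iff_mem_spectrum hc0).2 hc).exists_hasEigenvector
  have hv0 : v ≠ 0 := hv.2
  have hAv : A v = c • v := hv.apply_eq_smul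
  set e : H := ((‖v‖ : ℂ)⁻¹) • v with he
  have hen : ‖e‖ = 1 := by
    rw [he, norm_smul, norm_inv, Complex.norm_real, norm_norm,
      inv_mul_cancel₀ (norm_ne_zero_iff.2 hv0)]
  have hAe : A e = c • e := by rw [he, map_smul, hAv, smul_comm]
  have hSy : ∀ y, inner ℂ (S e) (S y) = (starRingEnd ℂ) c * inner ℂ e y := fun y => by
    rw [← ContinuousLinearMap.adjoint_inner_left, ← inner_smul_left, ← hAe]
    rfl
  -- Only the modulus of c is known so far; ⟨Se,Se⟩ = c̄ shows that it is real and non-negative.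
  have hcc : (starRingEnd ℂ) c = (‖S‖ ^ 2 : ℂ) := by
    have h1 := hSy e
    rw [inner_self_eq_norm_sq_to_K, inner_self_eq_norm_sq_to_K, hen] at h1
    have h2 : (starRingEnd ℂ) c = ((‖S e‖ ^ 2 : ℝ) : ℂ) := by
      rw [Complex.ofReal_pow]
      simpa using h1.symm
    have h3 := congrArg norm h2
    rw [RCLike.norm_conj, hcn', Complex.norm_real, Real.norm_of_nonneg (by positivity)] at h3
    rw [h2, ← h3, Complex.ofReal_pow]
  have he0 : e ≠ 0 := by
    intro h
    simp [h] at hen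
  exact ⟨e, Or.inr hen, fun h => absurd h he0, fun h => absurd h h0, fun y => by rw [hSy, hcc]⟩

/-- Greedy deflation: starting from T, each Sₙ is composed with the projection off its maximising
vector eₙ, and sₙ = ‖Sₙ‖. Projections are contractions, so sₙ decreases; sₙ = ‖T eₙ‖ → 0 because
Bessel's inequality makes (eₙ) weakly null and T is compact. -/
theorem exists_isCanonicalDecomposition [CompleteSpace H] {T : H →L[ℂ] H}
    (hT : IsCompactOperator T) :
    ∃ (s : ℕ → ℝ) (e σ : ℕ → H), IsCanonicalDecomposition T s e σ := by
  choose v hv01 hv0 hS0 hv using fun S : {S : H →L[ℂ] H // IsCompactOperator S} =>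
    exists_norm_attaining S.2
  let P : H → H →L[ℂ] H := fun x => ContinuousLinearMap.id ℂ H - (innerSL ℂ x).smulRight x
  have hP : ∀ x y, P x y = y - (inner ℂ x y : ℂ) • x := fun x y => by simp [P]
  let S' : ℕ → {S : H →L[ℂ] H // IsCompactOperator S} := fun n =>
    Nat.rec ⟨T, hT⟩ (fun _ S => ⟨S.1 ∘L P (v S), S.2.comp_clm _⟩) n
  let S : ℕ → H →L[ℂ] H := fun n => (S' n).1
  let e : ℕ → H := fun n => v (S' n)
  let s : ℕ → ℝ := fun n => ‖S n‖
  have hSzero : S 0 = T := rfl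
  have hSsucc : ∀ n y, S (n + 1) y = S n y - (inner ℂ (e n) y : ℂ) • S n (e n) := fun n y => by
    change S n (P (e n) y) = _
    rw [hP, map_sub, map_smul]
  have hinner : ∀ n y, (s n ^ 2 : ℂ) * inner ℂ (e n) y = inner ℂ (S n (e n)) (S n y) :=
    fun n y => hv (S' n) y
  have he01 : ∀ n, e n = 0 ∨ ‖e n‖ = 1 := fun n => hv01 (S' n)
  have hs0 : ∀ n, s n = 0 → e n = 0 := fun n h => hS0 (S' n) (norm_eq_zero.1 h)
  have he0 : ∀ n, e n = 0 → S n = 0 := fun n h => hv0 (S' n) h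
  -- Kernels increase because the eigenvector identity makes eₙ orthogonal to ker Sₙ. As eₖ is
  -- killed by S_{k+1}, orthogonality of later vectors to eₖ follows.
  have hker : ∀ n y, S n y = 0 → S (n + 1) y = 0 := fun n y h => by
    rw [hSsucc, h, zero_sub, neg_eq_zero]
    have h1 := hinner n y
    rw [h, inner_zero_right, mul_eq_zero] at h1
    rcases h1 with h1 | h1
    · have : e n = 0 := hs0 n (by simpa using h1)
      simp [this]
    · simp [h1]
  have hself : ∀ n, S (n + 1) (e n) = 0 := fun n => by
    rcases he01 n with h | h
    · simp [h]
    · rw [hSsucc, inner_self_eq_norm_sq_to_K, h]; simp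
  have hlt : ∀ k m, k < m → S m (e k) = 0 := fun k m hkm => by
    induction m, hkm using Nat.le_induction with
    | base => exact hself k
    | succ m _ ih => exact hker m _ ih
  have horth : ∀ k m, k < m → inner ℂ (e m) (e k) = 0 := fun k m hkm => by
    have h1 := hinner m (e k)
    rw [hlt k m hkm, inner_zero_right, mul_eq_zero] at h1
    rcases h1 with h1 | h1
    · have : e m = 0 := hs0 m (by simpa using h1)
      simp [this]
    · exact h1
  have hpo : IsPartialOrthonormal e := ⟨he01, fun j k hjk => by
    rcases lt_or_gt_of_ne hjk with h | h
    · rw [← inner_conj_symm, horth j k h, map_zero]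
    · exact horth k j h⟩
  have hTS : ∀ n y, (∀ k < n, inner ℂ (e k) y = 0) → S n y = T y := fun n y => by
    induction n with
    | zero => intro _; rfl
    | succ n ih =>
      intro h
      rw [hSsucc, h n n.lt_succ_self, zero_smul, sub_zero]
      exact ih fun k hk => h k (hk.trans n.lt_succ_self)
  have hTe : ∀ n, S n (e n) = T (e n) := fun n =>
    hTS n _ fun k hk => hpo.inner_eq_zero k n hk.ne
  have hTnorm : ∀ n, ‖T (e n)‖ = s n := fun n => by
    have h1 := hinner n (e n)
    rw [inner_self_eq_norm_sq_to_K, inner_self_eq_norm_sq_to_K, hTe] at h1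
    have h2 : s n ^ 2 * ‖e n‖ ^ 2 = ‖T (e n)‖ ^ 2 := by
      refine Complex.ofReal_injective ?_
      rw [Complex.ofReal_mul, Complex.ofReal_pow, Complex.ofReal_pow, Complex.ofReal_pow]
      exact h1
    have h3 : s n ^ 2 = ‖T (e n)‖ ^ 2 := by
      rcases he01 n with h | h
      · have : s n = 0 := norm_eq_zero.2 (he0 n h)
        simp [this, h]
      · simpa [h] using h2
    exact ((sq_eq_sq₀ (norm_nonneg _) (norm_nonneg _)).1 h3).symm
  have hTorth' : ∀ n m, n < m → inner ℂ (T (e n)) (T (e m)) = 0 := fun n m hnm => by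
    have h1 : S n (e m) = T (e m) := hTS n _ fun k hk => hpo.inner_eq_zero k m (hk.trans hnm).ne
    rw [← hTe n, ← h1, ← hinner, hpo.inner_eq_zero n m hnm.ne, mul_zero]
  have hTorth : ∀ n m, n ≠ m → inner ℂ (T (e n)) (T (e m)) = 0 := fun n m hnm => by
    rcases lt_or_gt_of_ne hnm with h | h
    · exact hTorth' n m h
    · rw [← inner_conj_symm, hTorth' m n h, map_zero]
  have hanti : Antitone s := antitone_nat_of_succ_le fun n => by
    refine ContinuousLinearMap.opNorm_le_bound _ (norm_nonneg _) fun y => ?_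
    have h1 := hpo.norm_sub_sum_le {n} y
    rw [Finset.sum_singleton] at h1
    rw [hSsucc, ← map_smul, ← map_sub]
    exact (ContinuousLinearMap.le_opNorm _ _).trans (mul_le_mul_of_nonneg_left h1 (norm_nonneg _))
  have hTe0 : Tendsto (fun n => T (e n)) atTop (𝓝 0) := by
    refine tendsto_zero_of_isCompactOperator hT hpo.norm_le_one (fun y : H => innerSL ℂ y)
      (fun x hx => inner_self_eq_zero.1 (hx x)) fun y => ?_
    have h1 : Summable fun n => ‖(inner ℂ (e n) (ContinuousLinearMap.adjoint T y) : ℂ)‖ ^ 2 := by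
      refine summable_of_sum_le (c := ‖ContinuousLinearMap.adjoint T y‖ ^ 2)
        (fun _ => by positivity) fun F => ?_
      rw [hpo.norm_sq_eq F]
      exact le_add_of_nonneg_right (by positivity)
    have h2 := h1.tendsto_atTop_zero.sqrt
    simp only [Real.sqrt_zero, Real.sqrt_sq (norm_nonneg _)] at h2
    rw [tendsto_zero_iff_norm_tendsto_zero]
    refine h2.congr fun n => ?_
    rw [innerSL_apply_apply, ContinuousLinearMap.adjoint_inner_right, ← inner_conj_symm, RCLike.norm_conj]
  have hslim : Tendsto s atTop (𝓝 0) := by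
    have := hTe0.norm
    simpa [hTnorm] using this
  refine ⟨s, e, fun n => ((s n : ℂ)⁻¹) • T (e n), fun n => norm_nonneg _, hanti, hslim, ?_, ?_, ?_⟩
  · refine ⟨fun n => (he01 n).resolve_left fun h => n.2 (norm_eq_zero.2 (he0 n h)), fun j k hjk => ?_⟩
    exact hpo.inner_eq_zero _ _ fun h => hjk (Subtype.ext h)
  · refine ⟨fun n => ?_, fun j k hjk => ?_⟩
    · rw [norm_smul, hTnorm, norm_inv, Complex.norm_real, Real.norm_of_nonneg (norm_nonneg _)]
      exact inv_mul_cancel₀ n.2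
    · change inner ℂ _ _ = (0 : ℂ)
      rw [inner_smul_left, inner_smul_right, hTorth _ _ fun h => hjk (Subtype.ext h)]
      simp
  · intro x
    have hterm : ∀ n, ((s n : ℂ) * inner ℂ (e n) x) • ((s n : ℂ)⁻¹ • T (e n)) =
        T ((inner ℂ (e n) x : ℂ) • e n) := fun n => by
      rw [map_smul]
      by_cases h : s n = 0
      · simp [hs0 n h]
      · have h' : (s n : ℂ) ≠ 0 := by exact_mod_cast h
        rw [smul_smul, mul_right_comm, mul_inv_cancel₀ h', one_mul]
    simp only [hterm]
    rw [HasSum, SummationFilter.unconditional_filter, Metric.tendsto_atTop]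
    intro ε hε
    obtain ⟨N, hN⟩ := Metric.tendsto_atTop.1 hslim (ε / (‖x‖ + 1)) (by positivity)
    refine ⟨Finset.range N, fun F hF => ?_⟩
    set y := x - ∑ k ∈ F, (inner ℂ (e k) x : ℂ) • e k with hy
    -- The remainder y is orthogonal to e₀, …, e_{N-1}, so T acts on it as S_N, of norm s_N. This
    -- holds for every F containing `Finset.range N`, as unconditional summation requires.
    have h1 : S N y = T y := hTS N y fun k hk =>
      hpo.inner_sub_sum F x (hF (Finset.mem_range.2 hk))
    have h2 : ‖T y‖ ≤ s N * ‖x‖ := by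
      rw [← h1]
      exact (ContinuousLinearMap.le_opNorm _ _).trans
        (mul_le_mul_of_nonneg_left (hpo.norm_sub_sum_le F x) (norm_nonneg _))
    have h3 := hN N le_rfl
    rw [Real.dist_eq, sub_zero, abs_of_nonneg (norm_nonneg _), lt_div_iff₀ (by positivity)] at h3
    rw [dist_comm, dist_eq_norm, ← map_sum, ← map_sub]
    refine h2.trans_lt (lt_of_le_of_lt ?_ h3)
    exact mul_le_mul_of_nonneg_left (by linarith) (norm_nonneg _)

namespace IsCanonicalDecomposition

variable {T : H →L[ℂ] H} {s : ℕ → ℝ} {e σ : ℕ → H}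

/-- A canonical decomposition leaves eₙ and σₙ arbitrary where sₙ = 0; setting them to 0 there makes
Bessel's inequality available for the full sequence. -/
theorem _root_.Orthonormal.isPartialOrthonormal_ite {s : ℕ → ℝ} {e : ℕ → H}
    (h : Orthonormal ℂ fun n : {n : ℕ // s n ≠ 0} => e n) :
    IsPartialOrthonormal fun n => if s n = 0 then 0 else e n := by
  refine ⟨fun n => ?_, fun j k hjk => ?_⟩
  · by_cases hn : s n = 0
    · simp [hn]
    · right
      simpa [hn] using h.1 ⟨n, hn⟩
  · by_cases hj : s j = 0
    · simp [hj]
    by_cases hk : s k = 0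
    · simp [hk]
    simpa [hj, hk] using h.2 (i := ⟨j, hj⟩) (j := ⟨k, hk⟩) (fun h => hjk (congrArg Subtype.val h))

/-- The vectors `e n` and `σ n` may be replaced by `0` when `s n = 0`. -/
theorem ite (h : IsCanonicalDecomposition T s e σ) : IsCanonicalDecomposition T s
    (fun n => if s n = 0 then 0 else e n) (fun n => if s n = 0 then 0 else σ n) := by
  refine ⟨h.nonneg, h.antitone, h.tendsto_zero, ?_, ?_, fun x => ?_⟩
  · convert h.orthonormal_left using 2 with n
    simp [n.2]
  · convert h.orthonormal_right using 2 with n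
    simp [n.2]
  · convert h.hasSum x using 2 with n
    by_cases hn : s n = 0 <;> simp [hn]

theorem norm_apply_sq_le (h : IsCanonicalDecomposition T s e σ) (hσ : IsPartialOrthonormal σ)
    (x : H) : ‖T x‖ₑ ^ 2 ≤ ∑' n, ENNReal.ofReal (s n) ^ 2 * ‖(inner ℂ (e n) x : ℂ)‖ₑ ^ 2 := by
  have h1 : Tendsto (fun F : Finset ℕ => ‖∑ n ∈ F, ((s n : ℂ) * inner ℂ (e n) x) • σ n‖ₑ ^ 2) atTop
      (𝓝 (‖T x‖ₑ ^ 2)) := by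
    have h2 := h.hasSum x
    rw [HasSum, SummationFilter.unconditional_filter] at h2
    exact (ENNReal.continuous_pow 2).continuousAt.tendsto.comp h2.enorm
  refine le_of_tendsto' h1 fun F => ?_
  refine le_trans ?_ (ENNReal.sum_le_tsum F)
  have h3 := ENNReal.ofReal_le_ofReal (hσ.norm_sum_sq_le F fun n => (s n : ℂ) * inner ℂ (e n) x)
  rw [ENNReal.ofReal_sum_of_nonneg fun _ _ => by positivity] at h3
  simp only [ENNReal.ofReal_pow (norm_nonneg _), ofReal_norm, enorm_mul, mul_pow] at h3
  refine h3.trans (le_of_eq (Finset.sum_congr rfl fun n _ => ?_))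
  rw [← ofReal_norm, Complex.norm_real, Real.norm_of_nonneg (h.nonneg n)]

theorem norm_apply_left (h : IsCanonicalDecomposition T s e σ) (he : IsPartialOrthonormal e)
    {n : ℕ} (hn : s n ≠ 0) : ‖T (e n)‖ = s n := by
  have hen : ‖e n‖ = 1 := h.orthonormal_left.1 ⟨n, hn⟩
  have hσn : ‖σ n‖ = 1 := h.orthonormal_right.1 ⟨n, hn⟩
  have h1 := h.hasSum (e n)
  have h2 := hasSum_single (f := fun k => ((s k : ℂ) * inner ℂ (e k) (e n)) • σ k) n
    fun k hk => by rw [he.inner_eq_zero k n hk, mul_zero, zero_smul]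
  rw [h1.unique h2, norm_smul, hσn, inner_self_eq_norm_sq_to_K, hen]
  simp [abs_of_nonneg (h.nonneg n)]

end IsCanonicalDecomposition

end Hilbert

/-- T is then a norm limit of the finite-rank operators T P_U, and compact operators form a closed
set. -/
theorem isCompactOperator_of_small_on_orthogonal {H : Type*} [NormedAddCommGroup H]
    [InnerProductSpace ℂ H] [CompleteSpace H] {T : H →L[ℂ] H}
    (h : ∀ ε > 0, ∃ U : Submodule ℂ H, FiniteDimensional ℂ U ∧ ∀ x ∈ Uᗮ, ‖T x‖ ≤ ε * ‖x‖) :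
    IsCompactOperator T := by
  refine isClosed_setOfPred_isCompactOperator.closure_subset (a := T) ?_
  rw [Metric.mem_closure_iff]
  intro ε hε
  obtain ⟨U, hU, hT⟩ := h (ε / 2) (half_pos hε)
  have : ProperSpace U := FiniteDimensional.proper ℂ U
  refine ⟨T ∘L U.starProjection, ?_, ?_⟩
  · exact (isCompactOperator_of_locallyCompactSpace_dom U.orthogonalProjectionOnto).clm_comp
      (T ∘L U.subtypeL)
  · refine lt_of_le_of_lt ?_ (half_lt_self hε)
    rw [dist_eq_norm]
    refine ContinuousLinearMap.opNorm_le_bound _ (half_pos hε).le fun x => ?_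
    have h1 : (T - T ∘L U.starProjection) x = T (x - U.starProjection x) := by
      rw [map_sub]; rfl
    rw [h1]
    refine (hT _ (U.sub_starProjection_mem_orthogonal x)).trans ?_
    refine mul_le_mul_of_nonneg_left ?_ (half_pos hε).le
    rw [← Submodule.starProjection_orthogonal_val]
    have h2 := Uᗮ.starProjection.le_of_opNorm_le Uᗮ.starProjection_norm_le x
    rwa [one_mul] at h2

theorem IsWeight.avg_eq {w : ℂ → ℝ} (μ : Measure ℂ) (r : ℝ) :
    avg μ w r = fun z => μ (Metric.ball z r) / weightMeasure w (Metric.ball z r) := by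
  funext z
  rw [avg, weightMeasure, withDensity_apply _ measurableSet_ball]

/-! ### Boundedness and compactness -/

section Composition

variable {α p R : ℝ} {A : ℝ≥0∞} {w : ℂ → ℝ} {φ ψ : ℂ → ℂ}

theorem IsLocalAp.wBounded (h : IsLocalAp p R A (weightMeasure w)) (hw : IsWeight w) (hp : 1 < p)
    (hR : 0 < R) (hA : A ≠ ⊤) (hα : 0 < α) (hφ : Differentiable ℂ φ) (hψ : Differentiable ℂ ψ)
    {r : ℝ} (hr : 0 < r) (hrR : r ≤ R / 2)
    (hM : (⨆ z, avg (pullbackMeasure α w φ ψ) w r z) < ⊤) : WBounded α w φ ψ := by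
  have := hw.isLocallyFiniteMeasure
  have := hw.isOpenPosMeasure
  have : SFinite (pullbackMeasure α w φ ψ) := IsWeight.sFinite_pullbackMeasure w φ ψ
  obtain ⟨C, hC, h1⟩ := h.carleson hp hR hA hα hr hrR
  rw [IsWeight.avg_eq] at hM
  refine hw.exists_isWeightedComposition hφ hψ (ENNReal.mul_ne_top hC hM.ne) fun F hF => ?_
  refine (h1 _ F hF).trans ?_
  rw [mul_assoc]
  refine mul_le_mul_right ?_ _
  rw [← lintegral_const_mul _ (measurable_fockDensity α hF.continuous)]
  refine lintegral_mono fun z => mul_le_mul_left ?_ _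
  exact le_iSup (fun z => pullbackMeasure α w φ ψ (Metric.ball z r) /
    weightMeasure w (Metric.ball z r)) z

/-- Gaussian test elements, normalised to be bounded in the Fock space. -/
theorem IsLocalAp.exists_test (h : IsLocalAp p R A (weightMeasure w)) (hw : IsWeight w) (hp : 1 < p)
    (hR : 0 < R) (hA : A ≠ ⊤) (hα : 0 < α) :
    ∃ (C : ℝ≥0∞) (u : ℂ → fockSpace α w) (c : ℂ → ℝ), C ≠ ⊤ ∧
      (∀ z, ENNReal.ofReal (c z) ^ 2 = (weightMeasure w (Metric.ball z R))⁻¹) ∧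
      (∀ z, 0 ≤ c z) ∧ (∀ z, rep (u z) = fun ζ => (c z : ℂ) * gaussTest α z ζ) ∧
      ∀ z, ‖u z‖ₑ ^ 2 ≤ C := by
  have := hw.isLocallyFiniteMeasure
  have := hw.isOpenPosMeasure
  set W := weightMeasure w with hW
  obtain ⟨C, hC, h1⟩ := h.gaussian_le hp hR hA hα
  have hk : ∀ z, ∃ k : fockSpace α w, rep k = gaussTest α z := fun z => by
    refine hw.exists_rep_eq (differentiable_gaussTest α z) ?_
    simp only [fockDensity_gaussTest]
    exact ((h1 z).trans_lt (ENNReal.mul_lt_top hC.lt_top (measure_ball_ne_top W z R).lt_top)).ne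
  choose k hk using hk
  have hsq : ∀ z, ENNReal.ofReal (Real.sqrt ((W (Metric.ball z R))⁻¹).toReal) ^ 2 =
      (W (Metric.ball z R))⁻¹ := fun z => by
    rw [← ENNReal.ofReal_pow (Real.sqrt_nonneg _), Real.sq_sqrt ENNReal.toReal_nonneg,
      ENNReal.ofReal_toReal (ENNReal.inv_ne_top.2 (measure_ball_ne_zero W z hR))]
  refine ⟨C, fun z => (Real.sqrt ((W (Metric.ball z R))⁻¹).toReal : ℂ) • k z,
    fun z => Real.sqrt ((W (Metric.ball z R))⁻¹).toReal, hC, hsq, fun z => Real.sqrt_nonneg _,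
    fun z => ?_, fun z => ?_⟩
  · rw [hw.rep_smul, hk]; rfl
  · have hk2 : ‖k z‖ₑ ^ 2 ≤ C * W (Metric.ball z R) := by
      rw [hw.enorm_sq, hk]
      simp only [fockDensity_gaussTest]
      exact h1 z
    rw [enorm_smul, mul_pow, ← ofReal_norm (_ : ℂ), Complex.norm_real,
      Real.norm_of_nonneg (Real.sqrt_nonneg _), hsq]
    refine (mul_le_mul_right hk2 _).trans (le_of_eq ?_)
    rw [mul_left_comm, ENNReal.inv_mul_cancel (measure_ball_ne_zero W z hR)
      (measure_ball_ne_top W z R), mul_one]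

/-- The averages of the pull-back measure are controlled by the operator on test elements. -/
theorem IsLocalAp.avg_le_test (h : IsLocalAp p R A (weightMeasure w)) (hw : IsWeight w)
    (hp : 1 < p) (hR : 0 < R) (hA : A ≠ ⊤) (hα : 0 < α) (hφ : Differentiable ℂ φ)
    (hψ : Differentiable ℂ ψ) {r : ℝ} (hr : 0 < r) (hrR : r ≤ R)
    {T : fockSpace α w →L[ℂ] fockSpace α w} (hT : IsWeightedComposition α w φ ψ T)
    {u : ℂ → fockSpace α w} {c : ℂ → ℝ}
    (hc : ∀ z, ENNReal.ofReal (c z) ^ 2 = (weightMeasure w (Metric.ball z R))⁻¹)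
    (hc0 : ∀ z, 0 ≤ c z) (hu : ∀ z, rep (u z) = fun ζ => (c z : ℂ) * gaussTest α z ζ) :
    ∃ C : ℝ≥0∞, C ≠ ⊤ ∧ ∀ z, avg (pullbackMeasure α w φ ψ) w r z ≤ C * ‖T (u z)‖ₑ ^ 2 := by
  have := hw.isLocallyFiniteMeasure
  have := hw.isOpenPosMeasure
  obtain ⟨C, hC, h1⟩ := h.measure_div_le_gaussTest hp hR hA hα hr hrR
  refine ⟨C, hC, fun z => ?_⟩
  rw [IsWeight.avg_eq, hT.enorm_sq hw hφ hψ, hu]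
  refine (h1 _ z).trans (le_of_eq ?_)
  rw [← lintegral_const_mul' _ _ (ENNReal.inv_ne_top.2 (measure_ball_ne_zero _ z hR))]
  congr 1
  refine lintegral_congr fun ζ => ?_
  rw [fockDensity, fockDensity, enorm_mul, mul_pow, ← ofReal_norm (c z : ℂ), Complex.norm_real,
    Real.norm_of_nonneg (hc0 z), hc, mul_assoc]

theorem IsLocalAp.iSup_avg_lt_top (h : IsLocalAp p R A (weightMeasure w)) (hw : IsWeight w)
    (hp : 1 < p) (hR : 0 < R) (hA : A ≠ ⊤) (hα : 0 < α) (hφ : Differentiable ℂ φ)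
    (hψ : Differentiable ℂ ψ) {r : ℝ} (hr : 0 < r) (hrR : r ≤ R) (hb : WBounded α w φ ψ) :
    (⨆ z, avg (pullbackMeasure α w φ ψ) w r z) < ⊤ := by
  obtain ⟨T, hT⟩ := hb
  obtain ⟨D, u, c, hD, hc, hc0, hu, huD⟩ := h.exists_test hw hp hR hA hα
  obtain ⟨C, hC, h1⟩ := h.avg_le_test hw hp hR hA hα hφ hψ hr hrR hT hc hc0 hu
  have hfin : C * (‖T‖ₑ ^ 2 * D) < ⊤ :=
    ENNReal.mul_lt_top hC.lt_top (ENNReal.mul_lt_top (by simp) hD.lt_top)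
  refine lt_of_le_of_lt (iSup_le fun z => (h1 z).trans (mul_le_mul_right ?_ _)) hfin
  calc ‖T (u z)‖ₑ ^ 2 ≤ (‖T‖ₑ * ‖u z‖ₑ) ^ 2 := by
        gcongr
        exact T.le_opENorm _
    _ ≤ ‖T‖ₑ ^ 2 * D := by
        rw [mul_pow]
        exact mul_le_mul_right (huD z) _

/-- The averages are dominated by ‖T u_z‖², so T u_z → 0 suffices. Since u_z is bounded and T
compact, it is enough that (T u_z)(ξ) → 0 for each ξ: the squared normalising factor grows at most
exponentially in |z|, while the bump at z evaluated at φ(ξ) decays like a Gaussian. -/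
theorem IsLocalAp.tendsto_avg_of_wCompact (h : IsLocalAp p R A (weightMeasure w)) (hw : IsWeight w)
    (hp : 1 < p) (hR : 0 < R) (hA : A ≠ ⊤) (hα : 0 < α) (hφ : Differentiable ℂ φ)
    (hψ : Differentiable ℂ ψ) {r : ℝ} (hr : 0 < r) (hrR : r ≤ R) (hcp : WCompact α w φ ψ) :
    (∀ z, avg (pullbackMeasure α w φ ψ) w r z < ⊤) ∧
      Tendsto (avg (pullbackMeasure α w φ ψ) w r) (cocompact ℂ) (𝓝 0) := by
  obtain ⟨T, hT, hTc⟩ := hcp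
  refine ⟨fun z => (le_iSup (avg (pullbackMeasure α w φ ψ) w r) z).trans_lt
    (h.iSup_avg_lt_top hw hp hR hA hα hφ hψ hr hrR ⟨T, hT⟩), ?_⟩
  have := hw.isLocallyFiniteMeasure
  have := hw.isOpenPosMeasure
  have hb := h.hasBoundedEvaluations hw hp hR hA hα
  obtain ⟨D, u, c, hD, hc, hc0, hu, huD⟩ := h.exists_test hw hp hR hA hα
  obtain ⟨C, hC, h1⟩ := h.avg_le_test hw hp hR hA hα hφ hψ hr hrR hT hc hc0 hu
  obtain ⟨K, κ, hK, hκ, hgr⟩ := h.growth hp hR hA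
  set W := weightMeasure w with hW
  have hub : ∀ z, ‖u z‖ ≤ Real.sqrt D.toReal := fun z => by
    have := norm_le_of_enorm_sq_le (x := u z) (y := (1 : ℝ)) hD (by simpa using huD z)
    simpa using this
  suffices hlim : Tendsto (fun z => T (u z)) (cocompact ℂ) (𝓝 0) by
    have h2 : Tendsto (fun z => C * ‖T (u z)‖ₑ ^ 2) (cocompact ℂ) (𝓝 0) := by
      have h3 : Tendsto (fun z => ‖T (u z)‖ₑ ^ 2) (cocompact ℂ) (𝓝 0) := by
        have h0 : ‖(0 : fockSpace α w)‖ₑ ^ 2 = 0 := by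
          rw [← ofReal_norm, norm_zero]; simp
        have := ((ENNReal.continuous_pow 2).tendsto _).comp hlim.enorm
        rwa [h0] at this
      simpa using ENNReal.Tendsto.const_mul h3 (Or.inr hC)
    exact tendsto_of_tendsto_of_tendsto_of_le_of_le tendsto_const_nhds h2 (fun _ => zero_le) h1
  refine tendsto_zero_of_isCompactOperator hTc hub (evalCLM hw hb)
    (fun f hf => eq_zero_of_rep_eq_zero hf) fun ξ => ?_
  simp only [evalCLM_apply, hT.rep_eq hw hφ hψ, hu]
  set ζ := φ ξ with hζ
  have hcoef : ∀ z, c z ^ 2 ≤ (W (Metric.ball 0 R))⁻¹.toReal * (K * Real.exp (κ * ‖z‖)) := by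
    intro z
    have h2 := ENNReal_inv_le (measure_ball_ne_zero W 0 hR) ENNReal.ofReal_ne_top (hgr z 0)
    rw [← hc, zero_sub, norm_neg] at h2
    have h3 := ENNReal.toReal_mono (ENNReal.mul_ne_top ENNReal.ofReal_ne_top
      (ENNReal.inv_ne_top.2 (measure_ball_ne_zero W 0 hR))) h2
    rw [ENNReal.toReal_pow, ENNReal.toReal_ofReal (hc0 z), ENNReal.toReal_mul,
      ENNReal.toReal_ofReal (by positivity)] at h3
    linarith
  set Q := (W (Metric.ball 0 R))⁻¹.toReal with hQ
  have hQ0 : 0 ≤ Q := ENNReal.toReal_nonneg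
  have hlim1 : Tendsto (fun z : ℂ => ‖z - ζ‖) (cocompact ℂ) atTop := by
    refine tendsto_atTop_mono (fun z => norm_sub_norm_le z ζ) ?_
    exact tendsto_atTop_add_const_right _ _ (tendsto_norm_cocompact_atTop)
  have hlim2 : Tendsto (fun t : ℝ => κ * t - α * t ^ 2) atTop atBot := by
    have h3 : Tendsto (fun t : ℝ => κ - α * t) atTop atBot :=
      tendsto_atBot_add_const_left _ _ (tendsto_neg_atTop_atBot.comp
        (tendsto_id.const_mul_atTop hα))
    refine (tendsto_id.atTop_mul_atBot₀ h3).congr fun t => ?_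
    simp only [id]; ring
  have hlim3 : Tendsto (fun z : ℂ => (‖ψ ξ‖ ^ 2 * Q * K * Real.exp (κ * ‖ζ‖ + α * ‖ζ‖ ^ 2)) *
      Real.exp (κ * ‖z - ζ‖ - α * ‖z - ζ‖ ^ 2)) (cocompact ℂ) (𝓝 0) := by
    simpa using (Real.tendsto_exp_atBot.comp (hlim2.comp hlim1)).const_mul
      (‖ψ ξ‖ ^ 2 * Q * K * Real.exp (κ * ‖ζ‖ + α * ‖ζ‖ ^ 2))
  have hlim4 : Tendsto (fun z => ‖ψ ξ * ((c z : ℂ) * gaussTest α z ζ)‖ ^ 2) (cocompact ℂ) (𝓝 0) := by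
    refine squeeze_zero (fun _ => by positivity) (fun z => ?_) hlim3
    rw [norm_mul, norm_mul, mul_pow, mul_pow, norm_gaussTest_sq, Complex.norm_real, Real.norm_eq_abs, sq_abs]
    have h4 : Real.exp (κ * ‖z‖) ≤ Real.exp (κ * ‖ζ‖ + κ * ‖z - ζ‖) := by
      refine Real.exp_le_exp.2 ?_
      rw [← mul_add]
      refine mul_le_mul_of_nonneg_left ?_ hκ
      calc ‖z‖ = ‖ζ + (z - ζ)‖ := by ring_nf
        _ ≤ _ := norm_add_le _ _
    calc ‖ψ ξ‖ ^ 2 * (c z ^ 2 * Real.exp (α * ‖ζ‖ ^ 2 - α * ‖ζ - z‖ ^ 2))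
        ≤ ‖ψ ξ‖ ^ 2 * (Q * (K * Real.exp (κ * ‖ζ‖ + κ * ‖z - ζ‖)) *
          Real.exp (α * ‖ζ‖ ^ 2 - α * ‖ζ - z‖ ^ 2)) := by
          gcongr
          exact (hcoef z).trans (by gcongr)
      _ = _ := by
          rw [norm_sub_rev ζ z, Real.exp_add, Real.exp_add, Real.exp_sub, Real.exp_sub]
          ring
  have hlim5 := hlim4.sqrt
  simp only [Real.sqrt_zero, Real.sqrt_sq (norm_nonneg _)] at hlim5
  exact tendsto_zero_iff_norm_tendsto_zero.2 hlim5

/-- The limit gives the bound 1 off a compact set. Finiteness of every average makes μ locally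
finite, and the growth bound keeps W(D(z,R)) away from 0 on bounded sets, which handles the rest. -/
theorem IsLocalAp.iSup_avg_lt_top_of_tendsto (h : IsLocalAp p R A (weightMeasure w))
    (hw : IsWeight w) (hp : 1 < p) (hR : 0 < R) (hA : A ≠ ⊤) {r : ℝ} (hr : 0 < r) (hrR : r ≤ R)
    {μ : Measure ℂ} (hfin : ∀ z, avg μ w r z < ⊤)
    (hlim : Tendsto (avg μ w r) (cocompact ℂ) (𝓝 0)) : (⨆ z, avg μ w r z) < ⊤ := by
  have := hw.isLocallyFiniteMeasure
  have := hw.isOpenPosMeasure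
  obtain ⟨C, hC, h1⟩ := h.inv_measure_ball_le hp hR hA hr hrR
  obtain ⟨K, κ, hK, hκ, hgr⟩ := h.growth hp hR hA
  rw [IsWeight.avg_eq] at hfin hlim ⊢
  set W := weightMeasure w with hW
  have hμ : IsLocallyFiniteMeasure μ := ⟨fun z => ⟨Metric.ball z r, Metric.ball_mem_nhds z hr, by
    by_contra hcon
    have h2 := hfin z
    simp only [not_lt, top_le_iff] at hcon
    simp [hcon, ENNReal.top_div_of_ne_top (measure_ball_ne_top W z r)] at h2⟩⟩
  have hev := hlim.eventually (ge_mem_nhds (zero_lt_one : (0 : ℝ≥0∞) < 1))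
  rw [eventually_iff, mem_cocompact] at hev
  obtain ⟨t, ht, htsub⟩ := hev
  obtain ⟨ρ, hρ⟩ := ht.isBounded.subset_closedBall 0
  set D := μ (Metric.ball 0 (ρ + r)) *
    (C * (ENNReal.ofReal (K * Real.exp (κ * ρ)) * (W (Metric.ball 0 R))⁻¹)) with hD
  have hDt : D < ⊤ := ENNReal.mul_lt_top measure_ball_lt_top (ENNReal.mul_lt_top hC.lt_top
    (ENNReal.mul_lt_top ENNReal.ofReal_lt_top
      (ENNReal.inv_ne_top.2 (measure_ball_ne_zero W 0 hR)).lt_top))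
  refine lt_of_le_of_lt (iSup_le fun z => ?_) (max_lt ENNReal.one_lt_top hDt)
  by_cases hz : z ∈ t
  · refine le_max_of_le_right ?_
    have hzρ : ‖z‖ ≤ ρ := by simpa using hρ hz
    change μ (Metric.ball z r) / W (Metric.ball z r) ≤ D
    rw [div_eq_mul_inv]
    refine mul_le_mul' (measure_mono (Metric.ball_subset_ball' ?_))
      ((h1 z).trans (mul_le_mul_right ?_ _))
    · rw [dist_zero_right]; linarith
    · refine (ENNReal_inv_le (measure_ball_ne_zero W 0 hR) ENNReal.ofReal_ne_top (hgr z 0)).trans ?_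
      gcongr
      simpa using hzρ
  · exact le_max_of_le_left (htsub hz)

/-- Finite codimension is obtained from vanishing on a finite net of a disc B outside which the
averages are at most η. The Lipschitz bound makes such f at most θ‖f‖ on B, so both parts of the
Carleson integral are small: the average outside B, the function inside. -/
theorem IsLocalAp.wCompact (h : IsLocalAp p R A (weightMeasure w)) (hw : IsWeight w) (hp : 1 < p)
    (hR : 0 < R) (hA : A ≠ ⊤) (hα : 0 < α) (hφ : Differentiable ℂ φ) (hψ : Differentiable ℂ ψ)
    {r : ℝ} (hr : 0 < r) (hrR : r ≤ R / 2)
    (hfin : ∀ z, avg (pullbackMeasure α w φ ψ) w r z < ⊤)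
    (hlim : Tendsto (avg (pullbackMeasure α w φ ψ) w r) (cocompact ℂ) (𝓝 0)) :
    WCompact α w φ ψ := by
  have hS := h.iSup_avg_lt_top_of_tendsto hw hp hR hA hr (by linarith) hfin hlim
  obtain ⟨T, hT⟩ := h.wBounded hw hp hR hA hα hφ hψ hr hrR hS
  refine ⟨T, hT, ?_⟩
  have := hw.isLocallyFiniteMeasure
  have := hw.isOpenPosMeasure
  have : SFinite (pullbackMeasure α w φ ψ) := IsWeight.sFinite_pullbackMeasure w φ ψ
  have hb := h.hasBoundedEvaluations hw hp hR hA hα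
  have := hb.completeSpace hw
  obtain ⟨C, hC, h1⟩ := h.carleson hp hR hA hα hr hrR
  set μ := pullbackMeasure α w φ ψ with hμ
  set S := ⨆ z, avg μ w r z with hSdef
  refine isCompactOperator_of_small_on_orthogonal fun ε hε => ?_
  -- choice of the parameters
  obtain ⟨η, hη0, hη⟩ : ∃ η : ℝ, 0 < η ∧ C * ENNReal.ofReal η ≤ ENNReal.ofReal (ε ^ 2 / 2) := by
    refine ⟨ε ^ 2 / 2 / (C.toReal + 1), by positivity, ?_⟩
    rw [← ENNReal.ofReal_toReal hC, ← ENNReal.ofReal_mul ENNReal.toReal_nonneg]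
    refine ENNReal.ofReal_le_ofReal ?_
    rw [mul_div_assoc', ENNReal.toReal_ofReal ENNReal.toReal_nonneg, div_le_iff₀ (by positivity)]
    nlinarith [sq_nonneg ε, ENNReal.toReal_nonneg (a := C)]
  have hev := hlim.eventually (ge_mem_nhds (ENNReal.ofReal_pos.2 hη0))
  rw [eventually_iff, mem_cocompact] at hev
  obtain ⟨t, ht, htsub⟩ := hev
  obtain ⟨ρ, hρ⟩ := ht.isBounded.subset_closedBall 0
  set B := Metric.closedBall (0 : ℂ) ρ with hB
  have hWB : weightMeasure w B ≠ ⊤ := (isCompact_closedBall (0 : ℂ) ρ).measure_lt_top.ne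
  obtain ⟨θ, hθ0, hθ⟩ : ∃ θ : ℝ, 0 < θ ∧
      C * (S * weightMeasure w B) * ENNReal.ofReal (θ ^ 2) ≤ ENNReal.ofReal (ε ^ 2 / 2) := by
    set E := C * (S * weightMeasure w B) with hE
    have hEt : E ≠ ⊤ := ENNReal.mul_ne_top hC (ENNReal.mul_ne_top hS.ne hWB)
    refine ⟨Real.sqrt (ε ^ 2 / 2 / (E.toReal + 1)), by positivity, ?_⟩
    rw [Real.sq_sqrt (by positivity), ← ENNReal.ofReal_toReal hEt,
      ← ENNReal.ofReal_mul ENNReal.toReal_nonneg]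
    refine ENNReal.ofReal_le_ofReal ?_
    rw [mul_div_assoc', ENNReal.toReal_ofReal ENNReal.toReal_nonneg, div_le_iff₀ (by positivity)]
    nlinarith [sq_nonneg ε, ENNReal.toReal_nonneg (a := E)]
  obtain ⟨L, hL0, hL⟩ := hb.lipschitz ρ
  obtain ⟨net, hnetB, hnetfin, hcover⟩ := (isCompact_closedBall (0 : ℂ) ρ).finite_cover_balls
    (e := θ / (L + 1)) (by positivity)
  -- Orthogonality to the Riesz representatives of the evaluations means vanishing on the net.
  refine ⟨Submodule.span ℂ ((fun z => (InnerProductSpace.toDual ℂ (fockSpace α w)).symm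
    (evalCLM hw hb z)) '' net), FiniteDimensional.span_of_finite ℂ (hnetfin.image _),
    fun f hf => ?_⟩
  have hzero : ∀ z ∈ net, rep f z = 0 := fun z hz => by
    have h2 := (Submodule.mem_orthogonal _ _).1 hf _ (Submodule.subset_span ⟨z, hz, rfl⟩)
    rwa [InnerProductSpace.toDual_symm_apply] at h2
  have hsmall : ∀ z ∈ B, ‖rep f z‖ ≤ θ * ‖f‖ := fun z hz => by
    obtain ⟨z', hz', hzz'⟩ := Set.mem_iUnion₂.1 (hcover hz)
    have h2 := hL f z z' (mem_closedBall_zero_iff.1 hz) (mem_closedBall_zero_iff.1 (hnetB hz'))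
    rw [hzero z' hz', sub_zero, ← dist_eq_norm] at h2
    rw [Metric.mem_ball, lt_div_iff₀ (by positivity)] at hzz'
    have h3 : 0 ≤ dist z z' := dist_nonneg
    calc ‖rep f z‖ ≤ L * ‖f‖ * dist z z' := h2
      _ = (dist z z' * L) * ‖f‖ := by ring
      _ ≤ θ * ‖f‖ := mul_le_mul_of_nonneg_right (by linarith) (norm_nonneg _)
  have hFm := measurable_fockDensity α (differentiable_rep f).continuous
  have hmain : ∫⁻ z, μ (Metric.ball z r) / weightMeasure w (Metric.ball z r) *
      fockDensity α (rep f) z ∂weightMeasure w ≤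
      ENNReal.ofReal η * ‖f‖ₑ ^ 2 + S * weightMeasure w B * (ENNReal.ofReal (θ ^ 2) * ‖f‖ₑ ^ 2) := by
    have hpt : ∀ z, μ (Metric.ball z r) / weightMeasure w (Metric.ball z r) *
        fockDensity α (rep f) z ≤ ENNReal.ofReal η * fockDensity α (rep f) z +
          B.indicator (fun _ => S * (ENNReal.ofReal (θ ^ 2) * ‖f‖ₑ ^ 2)) z := by
      intro z
      have havg : avg μ w r z = μ (Metric.ball z r) / weightMeasure w (Metric.ball z r) := by
        rw [IsWeight.avg_eq]
      rw [← havg]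
      by_cases hz : z ∈ B
      · rw [Set.indicator_of_mem hz]
        refine le_add_of_le_right (mul_le_mul' (le_iSup (avg μ w r) z) ?_)
        have h4 := ENNReal.ofReal_le_ofReal (pow_le_pow_left₀ (norm_nonneg _) (hsmall z hz) 2)
        rw [mul_pow, ENNReal.ofReal_mul (by positivity), ENNReal.ofReal_pow (norm_nonneg _),
          ENNReal.ofReal_pow (norm_nonneg f), ofReal_norm, ofReal_norm] at h4
        refine le_trans ?_ h4
        refine mul_le_of_le_one_right' ?_
        rw [ENNReal.ofReal_le_one, Real.exp_le_one_iff]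
        have : 0 ≤ α * ‖z‖ ^ 2 := by positivity
        linarith
      · rw [Set.indicator_of_notMem hz, add_zero]
        exact mul_le_mul_left (htsub fun hzt => hz (hρ hzt)) _
    refine (lintegral_mono hpt).trans (le_of_eq ?_)
    rw [lintegral_add_left (hFm.const_mul _), lintegral_const_mul _ hFm, ← hw.enorm_sq,
      lintegral_indicator measurableSet_closedBall, setLIntegral_const]
    ring
  have h5 : ‖T f‖ₑ ^ 2 ≤ ENNReal.ofReal (ε ^ 2) * ‖f‖ₑ ^ 2 := by
    rw [hT.enorm_sq hw hφ hψ]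
    calc _ ≤ C * (ENNReal.ofReal η * ‖f‖ₑ ^ 2 +
          S * weightMeasure w B * (ENNReal.ofReal (θ ^ 2) * ‖f‖ₑ ^ 2)) :=
          (h1 μ _ (differentiable_rep f)).trans (mul_le_mul_right hmain _)
      _ = (C * ENNReal.ofReal η + C * (S * weightMeasure w B) * ENNReal.ofReal (θ ^ 2)) *
          ‖f‖ₑ ^ 2 := by ring
      _ ≤ (ENNReal.ofReal (ε ^ 2 / 2) + ENNReal.ofReal (ε ^ 2 / 2)) * ‖f‖ₑ ^ 2 := by gcongr
      _ = _ := by rw [← ENNReal.ofReal_add (by positivity) (by positivity), add_halves]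
  have h6 := norm_le_of_enorm_sq_le ENNReal.ofReal_ne_top h5
  rwa [ENNReal.toReal_ofReal (by positivity), Real.sqrt_sq hε.le] at h6

end Composition

/-! ### Schatten classes -/

theorem lintegral_mul_sq_le {X : Type*} [MeasurableSpace X] {m : Measure X} {f g : X → ℝ≥0∞}
    (hf : AEMeasurable f m) (hg : AEMeasurable g m) :
    (∫⁻ x, f x * g x ∂m) ^ 2 ≤ (∫⁻ x, f x ^ 2 ∂m) * ∫⁻ x, g x ^ 2 ∂m := by
  have h1 := ENNReal.lintegral_mul_le_Lp_mul_Lq m Real.HolderConjugate.two_two hf hg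
  have h2 := pow_le_pow_left₀ zero_le h1 2
  refine h2.trans (le_of_eq ?_)
  rw [mul_pow, ← ENNReal.rpow_mul_natCast, ← ENNReal.rpow_mul_natCast]
  norm_num

theorem memLp_ofReal_iff {X : Type*} [MeasurableSpace X] {m : Measure X} {f : X → ℝ≥0∞}
    (hf : Measurable f) {q : ℝ} (hq : 0 < q) :
    MemLp f (ENNReal.ofReal q) m ↔ ∫⁻ x, f x ^ q ∂m < ⊤ := by
  have h0 : ENNReal.ofReal q ≠ 0 := by simpa using hq
  have h1 := eLpNorm_lt_top_iff_lintegral_rpow_enorm_lt_top (f := f) (μ := m) h0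
    ENNReal.ofReal_ne_top
  rw [ENNReal.toReal_ofReal hq.le] at h1
  simp only [enorm_eq_self] at h1
  rw [← h1]
  exact ⟨fun h => h.2, fun h => ⟨hf.aestronglyMeasurable, h⟩⟩

theorem summable_rpow_iff_tsum_ofReal {s : ℕ → ℝ} (hs : ∀ n, 0 ≤ s n) {P : ℝ} :
    (Summable fun n => s n ^ P) ↔ ∑' n, ENNReal.ofReal (s n ^ P) < ⊤ := by
  constructor
  · intro h
    exact h.tsum_ofReal_lt_top
  · intro h
    have h1 := ENNReal.summable_toReal h.ne
    refine h1.congr fun n => ?_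
    rw [ENNReal.toReal_ofReal (Real.rpow_nonneg (hs n) P)]

section Composition

variable {α p R : ℝ} {A : ℝ≥0∞} {w : ℂ → ℝ} {φ ψ : ℂ → ℂ}

theorem measurable_avg (hw : IsWeight w) (μ : Measure ℂ) [SFinite μ] (r : ℝ) :
    Measurable (avg μ w r) := by
  have := hw.isLocallyFiniteMeasure
  rw [IsWeight.avg_eq]
  exact (measurable_measure_ball μ r).div (measurable_measure_ball _ r)

/-- Cauchy–Schwarz after e^{-α|ζ-z|²/2} is split into two equal factors. One factor integrates to
O(W(D(z,R))), cancelling the normalisation of u_z; the other stays with f and makes the bound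
integrable in z over the whole plane. -/
theorem IsLocalAp.enorm_inner_sq_le (h : IsLocalAp p R A (weightMeasure w)) (hw : IsWeight w)
    (hp : 1 < p) (hR : 0 < R) (hA : A ≠ ⊤) (hα : 0 < α)
    {u : ℂ → fockSpace α w} {c : ℂ → ℝ}
    (hc : ∀ z, ENNReal.ofReal (c z) ^ 2 = (weightMeasure w (Metric.ball z R))⁻¹)
    (hc0 : ∀ z, 0 ≤ c z) (hu : ∀ z, rep (u z) = fun ζ => (c z : ℂ) * gaussTest α z ζ) :
    ∃ C : ℝ≥0∞, C ≠ ⊤ ∧ ∀ (f : fockSpace α w) (z : ℂ), ‖(inner ℂ f (u z) : ℂ)‖ₑ ^ 2 ≤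
      C * ∫⁻ ζ, fockDensity α (rep f) ζ * ENNReal.ofReal (Real.exp (-(α / 2) * ‖ζ - z‖ ^ 2))
        ∂weightMeasure w := by
  have := hw.isLocallyFiniteMeasure
  have := hw.isOpenPosMeasure
  obtain ⟨C, hC, h1⟩ := h.gaussian_le hp hR hA (half_pos hα)
  refine ⟨C, hC, fun f z => ?_⟩
  set W := weightMeasure w with hW
  set F := rep f with hF
  have hFc : Continuous F := (differentiable_rep f).continuous
  set X : ℂ → ℝ≥0∞ := fun ζ => ‖F ζ‖ₑ * ENNReal.ofReal (Real.exp (-(α / 2) * ‖ζ‖ ^ 2)) *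
    ENNReal.ofReal (Real.exp (-(α / 4) * ‖ζ - z‖ ^ 2)) with hX
  set Y : ℂ → ℝ≥0∞ := fun ζ => ENNReal.ofReal (Real.exp (-(α / 4) * ‖ζ - z‖ ^ 2)) with hY
  have hYm : Measurable Y := by fun_prop
  have hXm : Measurable X :=
    (hFc.enorm.measurable.mul (measurable_gaussian (α / 2))).mul hYm
  have hYsq : ∀ ζ, Y ζ ^ 2 = ENNReal.ofReal (Real.exp (-(α / 2) * ‖ζ - z‖ ^ 2)) := fun ζ => by
    rw [hY, ← ENNReal.ofReal_pow (by positivity), ← Real.exp_nat_mul]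
    congr 2
    push_cast
    ring
  have hXsq : ∀ ζ, X ζ ^ 2 = fockDensity α F ζ *
      ENNReal.ofReal (Real.exp (-(α / 2) * ‖ζ - z‖ ^ 2)) := fun ζ => by
    rw [← hYsq, hX, mul_pow, mul_pow, fockDensity]
    congr 2
    rw [← ENNReal.ofReal_pow (by positivity), ← Real.exp_nat_mul]
    congr 2
    push_cast
    ring
  have hle : ‖(inner ℂ f (u z) : ℂ)‖ₑ ≤ ENNReal.ofReal (c z) * ∫⁻ ζ, X ζ * Y ζ ∂W := by
    rw [Submodule.coe_inner, L2.inner_def]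
    refine (enorm_integral_le_lintegral_enorm _).trans ?_
    have h2 : ∫⁻ ζ, ‖(inner ℂ ((f : Lp ℂ 2 (fockMeasure α w)) ζ)
        ((u z : Lp ℂ 2 (fockMeasure α w)) ζ) : ℂ)‖ₑ ∂fockMeasure α w ≤
        ∫⁻ ζ, ‖F ζ‖ₑ * ‖rep (u z) ζ‖ₑ ∂fockMeasure α w := by
      refine lintegral_mono_ae ?_
      filter_upwards [coe_ae_eq_rep f, coe_ae_eq_rep (u z)] with ζ hζ hζ'
      rw [hζ, hζ']
      simp [enorm_mul, mul_comm, hF]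
    refine h2.trans ?_
    have hmul : Measurable fun ζ => ‖F ζ‖ₑ * ‖rep (u z) ζ‖ₑ :=
      hFc.enorm.measurable.mul (differentiable_rep (u z)).continuous.enorm.measurable
    have hXY : Measurable fun ζ => X ζ * Y ζ := hXm.mul hYm
    rw [hw.lintegral_fockMeasure α hmul, ← lintegral_const_mul _ hXY]
    refine lintegral_mono fun ζ => le_of_eq ?_
    rw [hu, enorm_mul, ← ofReal_norm (c z : ℂ), Complex.norm_real, Real.norm_of_nonneg (hc0 z),
      ← ofReal_norm (gaussTest α z ζ)]
    have hg : ‖gaussTest α z ζ‖ = Real.exp ((α * ‖ζ‖ ^ 2 - α * ‖ζ - z‖ ^ 2) / 2) := by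
      refine (sq_eq_sq₀ (norm_nonneg _) (by positivity)).1 ?_
      rw [norm_gaussTest_sq, ← Real.exp_nat_mul]
      congr 1
      push_cast
      ring
    have he : ENNReal.ofReal (Real.exp ((α * ‖ζ‖ ^ 2 - α * ‖ζ - z‖ ^ 2) / 2)) *
        ENNReal.ofReal (Real.exp (-α * ‖ζ‖ ^ 2)) =
        ENNReal.ofReal (Real.exp (-(α / 2) * ‖ζ‖ ^ 2)) *
        (ENNReal.ofReal (Real.exp (-(α / 4) * ‖ζ - z‖ ^ 2)) *
        ENNReal.ofReal (Real.exp (-(α / 4) * ‖ζ - z‖ ^ 2))) := by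
      rw [← ENNReal.ofReal_mul (by positivity), ← ENNReal.ofReal_mul (by positivity),
        ← ENNReal.ofReal_mul (by positivity), ← Real.exp_add, ← Real.exp_add, ← Real.exp_add]
      congr 2
      ring
    rw [hg, hX, hY]
    calc _ = ENNReal.ofReal (c z) * ‖F ζ‖ₑ *
          (ENNReal.ofReal (Real.exp ((α * ‖ζ‖ ^ 2 - α * ‖ζ - z‖ ^ 2) / 2)) *
          ENNReal.ofReal (Real.exp (-α * ‖ζ‖ ^ 2))) := by ring
      _ = _ := by rw [he]; ring
  calc ‖(inner ℂ f (u z) : ℂ)‖ₑ ^ 2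
      ≤ (W (Metric.ball z R))⁻¹ * ((∫⁻ ζ, X ζ ^ 2 ∂W) * ∫⁻ ζ, Y ζ ^ 2 ∂W) := by
        rw [← hc]
        refine (pow_le_pow_left₀ zero_le hle 2).trans ?_
        rw [mul_pow]
        exact mul_le_mul_right (lintegral_mul_sq_le hXm.aemeasurable hYm.aemeasurable) _
    _ ≤ (W (Metric.ball z R))⁻¹ * ((∫⁻ ζ, X ζ ^ 2 ∂W) * (C * W (Metric.ball z R))) := by
        simp only [hYsq]
        gcongr
        exact h1 z
    _ = C * (∫⁻ ζ, X ζ ^ 2 ∂W) * ((W (Metric.ball z R))⁻¹ * W (Metric.ball z R)) := by ring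
    _ = _ := by
        rw [ENNReal.inv_mul_cancel (measure_ball_ne_zero W z hR) (measure_ball_ne_top W z R),
          mul_one]
        simp only [hXsq]

theorem ofReal_rpow_eq_sq_rpow {x P : ℝ} (hx : 0 ≤ x) (hP : 0 ≤ P) :
    ENNReal.ofReal (x ^ P) = (ENNReal.ofReal x ^ 2) ^ (P / 2) := by
  rw [← ENNReal.ofReal_rpow_of_nonneg hx hP, ← ENNReal.rpow_natCast, ← ENNReal.rpow_mul]
  congr 1
  push_cast
  ring

/-- Jensen's inequality for sums, with weights |⟨eₙ,u_z⟩|² of total mass at most ‖u_z‖² by Bessel,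
bounds the q-th power of the average at z by a multiple of ∑ sₙ^P |⟨eₙ,u_z⟩|². Integration over z
leaves a multiple of ∑ sₙ^P. -/
theorem IsLocalAp.memLp_avg (h : IsLocalAp p R A (weightMeasure w)) (hw : IsWeight w)
    (hp : 1 < p) (hR : 0 < R) (hA : A ≠ ⊤) (hα : 0 < α) (hφ : Differentiable ℂ φ)
    (hψ : Differentiable ℂ ψ) {r : ℝ} (hr : 0 < r) (hrR : r ≤ R) {P : ℝ} (hP : 2 ≤ P)
    (hS : WSchatten α w φ ψ P) :
    MemLp (avg (pullbackMeasure α w φ ψ) w r) (ENNReal.ofReal (P / 2)) volume := by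
  obtain ⟨T, hT, -, s, e, σ, hdec, hsum⟩ := hS
  have := hw.isLocallyFiniteMeasure
  have := hw.isOpenPosMeasure
  have : SFinite (pullbackMeasure α w φ ψ) := IsWeight.sFinite_pullbackMeasure w φ ψ
  have hq : 1 ≤ P / 2 := by linarith
  have hq0 : 0 < P / 2 := by linarith
  rw [memLp_ofReal_iff (measurable_avg hw _ r) hq0]
  obtain ⟨D, u, c, hD, hc, hc0, hu, huD⟩ := h.exists_test hw hp hR hA hα
  obtain ⟨C, hC, h1⟩ := h.avg_le_test hw hp hR hA hα hφ hψ hr hrR hT hc hc0 hu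
  obtain ⟨C', hC', h2⟩ := h.enorm_inner_sq_le hw hp hR hA hα hc hc0 hu
  set e' : ℕ → fockSpace α w := fun n => if s n = 0 then 0 else e n with he'
  have heo : IsPartialOrthonormal e' := hdec.orthonormal_left.isPartialOrthonormal_ite
  have hσo := hdec.orthonormal_right.isPartialOrthonormal_ite
  set W := weightMeasure w with hW
  set q := P / 2 with hqdef
  set I := ∫⁻ z : ℂ, ENNReal.ofReal (Real.exp (-(α / 2) * ‖z‖ ^ 2)) with hI
  have hIt : I < ⊤ := lintegral_gaussian_lt_top (half_pos hα)
  set J : ℕ → ℂ → ℝ≥0∞ := fun n z => ∫⁻ ζ, fockDensity α (rep (e' n)) ζ *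
    ENNReal.ofReal (Real.exp (-(α / 2) * ‖ζ - z‖ ^ 2)) ∂W with hJ
  have hker : ∀ n, Measurable (Function.uncurry fun z ζ : ℂ => fockDensity α (rep (e' n)) ζ *
      ENNReal.ofReal (Real.exp (-(α / 2) * ‖ζ - z‖ ^ 2))) := fun n => by
    have h3 := measurable_fockDensity α (differentiable_rep (e' n)).continuous
    refine (h3.comp measurable_snd).mul ?_
    fun_prop
  have hJm : ∀ n, Measurable (J n) := fun n => (hker n).lintegral_prod_right'
  -- By Tonelli the integral over z of the translated Gaussian is the constant I, and what remains
  -- is ‖e'ₙ‖² ≤ 1.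
  have hJI : ∀ n, ∫⁻ z, J n z ≤ I := fun n => by
    have hfm := measurable_fockDensity α (differentiable_rep (e' n)).continuous
    rw [hJ, lintegral_lintegral_swap (hker n).aemeasurable]
    have h4 : ∀ ζ, ∫⁻ z, fockDensity α (rep (e' n)) ζ *
        ENNReal.ofReal (Real.exp (-(α / 2) * ‖ζ - z‖ ^ 2)) = fockDensity α (rep (e' n)) ζ * I := by
      intro ζ
      rw [lintegral_const_mul _ (by fun_prop)]
      simp only [norm_sub_rev ζ]
      rw [lintegral_gaussian_sub]
    simp only [h4]
    rw [lintegral_mul_const _ hfm, ← hw.enorm_sq]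
    refine mul_le_of_le_one_left' ?_
    have h5 : ‖e' n‖ₑ ≤ 1 := by
      rw [← ofReal_norm]
      exact ENNReal.ofReal_le_one.2 (heo.norm_le_one n)
    exact pow_le_one₀ zero_le h5
  have hpt : ∀ z, avg (pullbackMeasure α w φ ψ) w r z ^ q ≤
      C ^ q * D ^ (q - 1) * C' * ∑' n, ENNReal.ofReal (s n ^ P) * J n z := by
    intro z
    have h6 := hdec.ite.norm_apply_sq_le hσo (u z)
    have h7 := heo.tsum_enorm_inner_sq_le (u z)
    calc avg (pullbackMeasure α w φ ψ) w r z ^ q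
        ≤ (C * ∑' n, ENNReal.ofReal (s n) ^ 2 * ‖(inner ℂ (e' n) (u z) : ℂ)‖ₑ ^ 2) ^ q :=
          ENNReal.rpow_le_rpow ((h1 z).trans (mul_le_mul_right h6 _)) hq0.le
      _ ≤ C ^ q * ((∑' n, ‖(inner ℂ (e' n) (u z) : ℂ)‖ₑ ^ 2) ^ (q - 1) *
          ∑' n, (ENNReal.ofReal (s n) ^ 2) ^ q * ‖(inner ℂ (e' n) (u z) : ℂ)‖ₑ ^ 2) := by
          rw [ENNReal.mul_rpow_of_nonneg _ _ hq0.le]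
          exact mul_le_mul_right (tsum_mul_rpow_le hq _ _) _
      _ ≤ C ^ q * (D ^ (q - 1) * ∑' n, ENNReal.ofReal (s n ^ P) * (C' * J n z)) := by
          refine mul_le_mul_right (mul_le_mul' ?_ (ENNReal.tsum_le_tsum fun n => ?_)) _
          · exact ENNReal.rpow_le_rpow (h7.trans (huD z)) (by linarith)
          · rw [ofReal_rpow_eq_sq_rpow (hdec.nonneg n) (by linarith)]
            exact mul_le_mul_right (h2 (e' n) z) _
      _ = _ := by
          simp only [mul_left_comm _ C', ENNReal.tsum_mul_left]
          ring
  refine (lintegral_mono hpt).trans_lt ?_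
  rw [lintegral_const_mul _ (Measurable.tsum fun n => (hJm n).const_mul _),
    lintegral_tsum fun n => ((hJm n).const_mul _).aemeasurable]
  refine ENNReal.mul_lt_top (ENNReal.mul_lt_top (ENNReal.mul_lt_top
    (ENNReal.rpow_lt_top_of_nonneg hq0.le hC) (ENNReal.rpow_lt_top_of_nonneg (by linarith) hD))
    hC'.lt_top) ?_
  have h8 : ∑' n, ∫⁻ z, ENNReal.ofReal (s n ^ P) * J n z ≤
      (∑' n, ENNReal.ofReal (s n ^ P)) * I := by
    rw [← ENNReal.tsum_mul_right]
    refine ENNReal.tsum_le_tsum fun n => ?_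
    rw [lintegral_const_mul _ (hJm n)]
    exact mul_le_mul_right (hJI n) _
  exact h8.trans_lt (ENNReal.mul_lt_top
    ((summable_rpow_iff_tsum_ofReal hdec.nonneg).1 hsum) hIt)

theorem exists_enorm_apply_eq_enorm_inner {H : Type*} [NormedAddCommGroup H]
    [InnerProductSpace ℂ H] [CompleteSpace H] (l : H →L[ℂ] ℂ) :
    ∃ k : H, (∀ f, ‖l f‖ₑ = ‖(inner ℂ f k : ℂ)‖ₑ) ∧ ‖l k‖ₑ = ‖k‖ₑ ^ 2 := by
  have hl : ∀ f, l f = inner ℂ ((InnerProductSpace.toDual ℂ H).symm l) f := fun f =>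
    InnerProductSpace.toDual_symm_apply.symm
  refine ⟨(InnerProductSpace.toDual ℂ H).symm l, fun f => ?_, ?_⟩
  · rw [hl, ← ofReal_norm, ← ofReal_norm, norm_inner_symm]
  · rw [hl, inner_self_eq_norm_sq_to_K, enorm_pow, ← ofReal_norm, RCLike.norm_ofReal, abs_norm,
      ofReal_norm]

/-- The diagonal of the reproducing kernel is controlled by the weight. -/
theorem IsLocalAp.tsum_fockDensity_le (h : IsLocalAp p R A (weightMeasure w)) (hw : IsWeight w)
    (hp : 1 < p) (hR : 0 < R) (hA : A ≠ ⊤) (hα : 0 < α) :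
    ∃ C : ℝ≥0∞, C ≠ ⊤ ∧ ∀ e : ℕ → fockSpace α w, IsPartialOrthonormal e → ∀ z,
      ∑' n, fockDensity α (rep (e n)) z ≤ C * (weightMeasure w (Metric.ball z R))⁻¹ := by
  have := hw.isLocallyFiniteMeasure
  have := hw.isOpenPosMeasure
  have hb := h.hasBoundedEvaluations hw hp hR hA hα
  have := hb.completeSpace hw
  obtain ⟨C, hC, h1⟩ := h.pointwise_le hp hA α hα hR le_rfl
  refine ⟨C, hC, fun e he z => ?_⟩
  set W := weightMeasure w with hW
  obtain ⟨k, hki, hkk⟩ := exists_enorm_apply_eq_enorm_inner (evalCLM hw hb z)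
  change ∀ f, ‖rep f z‖ₑ = _ at hki
  change ‖rep k z‖ₑ = _ at hkk
  set E := ENNReal.ofReal (Real.exp (-α * ‖z‖ ^ 2)) with hE
  have h2 : ∑' n, fockDensity α (rep (e n)) z ≤ ‖k‖ₑ ^ 2 * E := by
    simp only [fockDensity]
    rw [ENNReal.tsum_mul_right]
    refine mul_le_mul_left (le_trans (le_of_eq ?_) (he.tsum_enorm_inner_sq_le k)) _
    refine tsum_congr fun n => ?_
    rw [hki]
  refine h2.trans ?_
  rw [mul_comm C]
  refine ENNReal_le_inv_mul (measure_ball_ne_zero W z hR) (measure_ball_ne_top W z R) ?_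
  by_cases hk0 : ‖k‖ₑ ^ 2 = 0
  · simp [hk0]
  have hkt : ‖k‖ₑ ^ 2 ≠ ⊤ := by simp
  -- The pointwise estimate is applied to the kernel k itself. Since |k(z)| = ‖k‖², one factor ‖k‖²
  -- cancels and the bound for ‖k‖² e^{-α|z|²} remains.
  have h3 : W (Metric.ball z R) * fockDensity α (rep k) z ≤ C * ‖k‖ₑ ^ 2 := by
    rw [hw.enorm_sq]
    exact (h1 _ (differentiable_rep k) z).trans
      (mul_le_mul_right (setLIntegral_le_lintegral _ _) _)
  have h4 : fockDensity α (rep k) z = ‖k‖ₑ ^ 2 * (‖k‖ₑ ^ 2 * E) := by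
    rw [fockDensity, hkk, ← hE]
    ring
  rw [h4, mul_left_comm, mul_comm C] at h3
  exact (ENNReal.mul_le_mul_iff_right hk0 hkt).1 h3

/-- Integrability at radius r is used twice at radius r/2: pointwise decay there gives compactness,
hence a canonical decomposition, and the weighted integral of the averages bounds the sum of the
sₙ^P. Jensen is applied to the measure |eₙ|² e^{-α|·|²} dW of mass at most 1, before summation over
n. -/
theorem IsLocalAp.wSchatten (h : IsLocalAp p R A (weightMeasure w)) (hw : IsWeight w)
    (hp : 1 < p) (hR : 0 < R) (hA : A ≠ ⊤) (hα : 0 < α) (hφ : Differentiable ℂ φ)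
    (hψ : Differentiable ℂ ψ) {r : ℝ} (hr : 0 < r) (hrR : r ≤ R / 2) {P : ℝ} (hP : 2 ≤ P)
    (hM : MemLp (avg (pullbackMeasure α w φ ψ) w r) (ENNReal.ofReal (P / 2)) volume) :
    WSchatten α w φ ψ P := by
  have := hw.isLocallyFiniteMeasure
  have := hw.isOpenPosMeasure
  have : SFinite (pullbackMeasure α w φ ψ) := IsWeight.sFinite_pullbackMeasure w φ ψ
  have hq : 1 ≤ P / 2 := by linarith
  have hq0 : 0 < P / 2 := by linarith
  rw [memLp_ofReal_iff (measurable_avg hw _ r) hq0] at hM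
  simp only [IsWeight.avg_eq] at hM
  have hb := h.hasBoundedEvaluations hw hp hR hA hα
  have := hb.completeSpace hw
  set μ := pullbackMeasure α w φ ψ with hμ
  obtain ⟨hfin, hlim⟩ := h.tendsto_measure_div hp hR hA hr hrR hq0 μ hM
  obtain ⟨T, hT, hTc⟩ := h.wCompact hw hp hR hA hα hφ hψ (half_pos hr) (by linarith)
    (fun z => by rw [IsWeight.avg_eq]; exact hfin z) (by rw [IsWeight.avg_eq]; exact hlim)
  obtain ⟨s, e, σ, hdec'⟩ := exists_isCanonicalDecomposition hTc
  have hdec := hdec'.ite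
  have heo := hdec'.orthonormal_left.isPartialOrthonormal_ite
  set e' : ℕ → fockSpace α w := fun n => if s n = 0 then 0 else e n with he'
  refine ⟨T, hT, hTc, s, e', _, hdec, ?_⟩
  rw [summable_rpow_iff_tsum_ofReal hdec.nonneg]
  obtain ⟨C, hC, h1⟩ := h.carleson hp hR hA hα (half_pos hr) (by linarith)
  obtain ⟨C₂, hC₂, h2⟩ := h.tsum_fockDensity_le hw hp hR hA hα
  obtain ⟨C₃, hC₃, h3⟩ := h.lintegral_measure_div_rpow_le hp hR hA hr hrR hq0
  set W := weightMeasure w with hW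
  set q := P / 2 with hqdef
  set M : ℂ → ℝ≥0∞ := fun z => μ (Metric.ball z (r / 2)) / W (Metric.ball z (r / 2)) with hMdef
  have hMm : Measurable M := (measurable_measure_ball μ _).div (measurable_measure_ball W _)
  have hfm : ∀ n, Measurable (fockDensity α (rep (e' n))) := fun n =>
    measurable_fockDensity α (differentiable_rep (e' n)).continuous
  have hterm : ∀ n, ENNReal.ofReal (s n ^ P) ≤
      C ^ q * ∫⁻ z, M z ^ q * fockDensity α (rep (e' n)) z ∂W := by
    intro n
    by_cases hn : s n = 0
    · rw [hn, Real.zero_rpow (by linarith)]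
      simp
    rw [ofReal_rpow_eq_sq_rpow (hdec.nonneg n) (by linarith), ← hdec.norm_apply_left heo hn,
      ofReal_norm, hT.enorm_sq hw hφ hψ]
    have h4 : ∫⁻ z, fockDensity α (rep (e' n)) z ∂W ≤ 1 := by
      rw [← hw.enorm_sq]
      have h5 : ‖e' n‖ₑ ≤ 1 := by
        rw [← ofReal_norm]
        exact ENNReal.ofReal_le_one.2 (heo.norm_le_one n)
      exact pow_le_one₀ zero_le h5
    calc _ ≤ (C * ∫⁻ z, M z * fockDensity α (rep (e' n)) z ∂W) ^ q :=
          ENNReal.rpow_le_rpow (h1 μ _ (differentiable_rep _)) hq0.le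
      _ ≤ C ^ q * ((∫⁻ z, fockDensity α (rep (e' n)) z ∂W) ^ (q - 1) *
          ∫⁻ z, M z ^ q * fockDensity α (rep (e' n)) z ∂W) := by
          rw [ENNReal.mul_rpow_of_nonneg _ _ hq0.le]
          exact mul_le_mul_right
            (lintegral_mul_rpow_le hq hMm.aemeasurable (hfm n).aemeasurable) _
      _ ≤ _ := mul_le_mul_right (mul_le_of_le_one_left'
          (ENNReal.rpow_le_one h4 (by linarith))) _
  refine (ENNReal.tsum_le_tsum hterm).trans_lt ?_
  have hMf : ∀ n, AEMeasurable (fun z => M z ^ q * fockDensity α (rep (e' n)) z) W := fun n =>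
    ((hMm.pow_const q).mul (hfm n)).aemeasurable
  rw [ENNReal.tsum_mul_left, ← lintegral_tsum hMf]
  refine ENNReal.mul_lt_top (ENNReal.rpow_lt_top_of_nonneg hq0.le hC) ?_
  simp only [ENNReal.tsum_mul_left]
  have h6 : ∫⁻ z, M z ^ q * ∑' n, fockDensity α (rep (e' n)) z ∂W ≤
      C₂ * ∫⁻ z, M z ^ q * (W (Metric.ball z R))⁻¹ ∂W := by
    rw [← lintegral_const_mul' _ _ hC₂]
    refine lintegral_mono fun z => ?_
    rw [mul_left_comm]
    exact mul_le_mul_right (h2 e' heo z) _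
  refine h6.trans_lt (ENNReal.mul_lt_top hC₂.lt_top ((h3 μ).trans_lt ?_))
  exact ENNReal.mul_lt_top hC₃.lt_top hM

end Composition

end WeightedFock

end

theorem corollary6p2 (α : ℝ) (hα : 0 < α) (w : ℂ → ℝ) (hw : WeightedFock.IsRestrictedAInfty w) :
    ∃ δ : ℝ, 0 < δ ∧ δ < 1 ∧ ∀ φ ψ : ℂ → ℂ, Differentiable ℂ φ → Differentiable ℂ ψ →
      -- boundedness, for some and for any radius
      ((WeightedFock.WBounded α w φ ψ ↔ ∃ r ∈ Set.Ioo 0 δ,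
          (⨆ z, WeightedFock.avg (WeightedFock.pullbackMeasure α w φ ψ) w r z) < ⊤) ∧
       (WeightedFock.WBounded α w φ ψ ↔ ∀ r ∈ Set.Ioo 0 δ,
          (⨆ z, WeightedFock.avg (WeightedFock.pullbackMeasure α w φ ψ) w r z) < ⊤)) ∧
      -- compactness
      ((WeightedFock.WCompact α w φ ψ ↔ ∃ r ∈ Set.Ioo 0 δ,
          (∀ z, WeightedFock.avg (WeightedFock.pullbackMeasure α w φ ψ) w r z < ⊤) ∧
          Tendsto (WeightedFock.avg (WeightedFock.pullbackMeasure α w φ ψ) w r)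
            (cocompact ℂ) (𝓝 0)) ∧
       (WeightedFock.WCompact α w φ ψ ↔ ∀ r ∈ Set.Ioo 0 δ,
          (∀ z, WeightedFock.avg (WeightedFock.pullbackMeasure α w φ ψ) w r z < ⊤) ∧
          Tendsto (WeightedFock.avg (WeightedFock.pullbackMeasure α w φ ψ) w r)
            (cocompact ℂ) (𝓝 0))) ∧
      -- Schatten classes
      (∀ p : ℝ, 2 ≤ p →
        (WeightedFock.WSchatten α w φ ψ p ↔ ∃ r ∈ Set.Ioo 0 δ,
          MemLp (WeightedFock.avg (WeightedFock.pullbackMeasure α w φ ψ) w r)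
            (ENNReal.ofReal (p / 2)) volume) ∧
        (WeightedFock.WSchatten α w φ ψ p ↔ ∀ r ∈ Set.Ioo 0 δ,
          MemLp (WeightedFock.avg (WeightedFock.pullbackMeasure α w φ ψ) w r)
            (ENNReal.ofReal (p / 2)) volume)) := by
  obtain ⟨p, R, A, hp, hR, hA, h⟩ := hw.exists_isLocalAp
  have hw' := hw.isWeight
  -- R/2 is the largest radius allowed in the sufficiency results; 1/2 only serves to keep δ below
  -- 1. Necessity holds up to R, so one radius below δ implies all of them through the operator.
  have hδ0 : 0 < min (1 / 2) (R / 2) := lt_min one_half_pos (half_pos hR)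
  -- a property that implies the condition at all radii, and follows from it at one radius
  have key : ∀ (Q : Prop) (M : ℝ → Prop),
      (Q → ∀ r, 0 < r → r ≤ R → M r) → (∀ r, 0 < r → r ≤ R / 2 → M r → Q) →
      (Q ↔ ∃ r ∈ Set.Ioo 0 (min (1 / 2) (R / 2)), M r) ∧
        (Q ↔ ∀ r ∈ Set.Ioo 0 (min (1 / 2) (R / 2)), M r) := by
    intro Q M hQM hMQ
    have hall : Q → ∀ r ∈ Set.Ioo 0 (min (1 / 2) (R / 2)), M r := fun hQ r hr =>
      hQM hQ r hr.1 (by linarith [hr.2, min_le_right (1 / 2) (R / 2)])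
    have hex : (∃ r ∈ Set.Ioo 0 (min (1 / 2) (R / 2)), M r) → Q := fun ⟨r, hr, hM⟩ =>
      hMQ r hr.1 (hr.2.le.trans (min_le_right _ _)) hM
    have hmem : min (1 / 2) (R / 2) / 2 ∈ Set.Ioo 0 (min (1 / 2) (R / 2)) :=
      ⟨half_pos hδ0, half_lt_self hδ0⟩
    exact ⟨⟨fun hQ => ⟨_, hmem, hall hQ _ hmem⟩, hex⟩, hall, fun hM => hex ⟨_, hmem, hM _ hmem⟩⟩
  refine ⟨min (1 / 2) (R / 2), hδ0, (min_le_left _ _).trans_lt one_half_lt_one,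
    fun φ ψ hφ hψ => ⟨?_, ?_, fun P hP => ?_⟩⟩
  · exact key _ _ (fun hQ r hr hrR => h.iSup_avg_lt_top hw' hp hR hA hα hφ hψ hr hrR hQ)
      (fun r hr hrR hM => h.wBounded hw' hp hR hA hα hφ hψ hr hrR hM)
  · exact key _ _ (fun hQ r hr hrR => h.tendsto_avg_of_wCompact hw' hp hR hA hα hφ hψ hr hrR hQ)
      (fun r hr hrR hM => h.wCompact hw' hp hR hA hα hφ hψ hr hrR hM.1 hM.2)
  · exact key _ _ (fun hQ r hr hrR => h.memLp_avg hw' hp hR hA hα hφ hψ hr hrR hP hQ)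
      (fun r hr hrR hM => h.wSchatten hw' hp hR hA hα hφ hψ hr hrR hP hM)
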